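/- Let $E$ be a real Banach space that is 2-uniformly convex (its modulus of convexity $\delta_E(\varepsilon)=\inf\{1-\|\tfrac{x+y}{2}\| : \|x\|,\|y\|\le 1,\ \|x-y\|\ge\varepsilon\}$ satisfies $\delta_E(\varepsilon)\ge c\varepsilon^2$ on $[0,2]$ for some $c>0$) and uniformly smooth (the limit $\lim_{t\to0}(\|x+ty\|-\|x\|)/t$ exists uniformly for $x,y$ in the unit sphere). Let $J:E\to E^*$ be the normalized duality mapping, $\langle Jx,x\rangle=\|Jx\|^2=\|x\|^2$ (it is single-valued and bijective here), and let $\phi(x,y)=\|x\|^2-2\langle Jy,x\rangle+\|y\|^2$. For a closed convex nonempty $C\subseteq E$, the generalized projection $\Pi_C(x)$ is the unique minimizer of $y\mapsto\phi(y,x)$ over $C$. Let $B:E\to2^{E^*}$ be maximal monotone, let $A:E\to E^*$ be monotone and $L$-Lipschitz continuous with $L>0$, and suppose that $(A+B)^{-1}(0)=\{x : 0\in Ax+Bx\}$ is nonempty. For $r>0$ let $J_r^B=(J+rB)^{-1}J$ be the resolvent of $B$. Let $\mu\ge1$ be the 2-uniform convexity constant of $E$, that is, the least $\mu\ge 1$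 with $\tfrac12(\|x+y\|^2+\|x-y\|^2)\ge\|x\|^2+\|\mu^{-1}y\|^2$ for all $x,y\in E$. Let $\kappa$ be the 2-uniform smoothness constant of $E^*$, that is, the least $\kappa>0$ with $\|f+g\|^2\le\|f\|^2+2\langle J_*f,g\rangle+2\kappa^2\|g\|^2$ for all $f,g\in E^*$, where $J_*$ is the normalized duality mapping of $E^*$ (if $E=\{0\}$, put $\kappa=0$). Let $(\lambda_n)_{n\ge1}$ be real numbers with $$0<a\le\lambda_n\le b \quad (n\ge1),\qquad \sqrt2\,\mu\,\kappa\,L\,b<1,$$ and let $(\alpha_n)_{n\ge1}$ be a sequence in $(0,1)$. Given $x_1\in E$, define for $n\ge1$ $$y_n=J_{\lambda_n}^B J^{-1}(Jx_n-\lambda_nAx_n),\qquad w_n=J^{-1}\big[Jy_n-\lambda_n(Ay_n-Ax_n)\big],\qquad x_{n+1}=J^{-1}\big[\alpha_nJx_1+(1-\alpha_n)Jw_n\big].$$ **Theorem.** If $\lim_{n\to\infty}\alpha_n=0$ and $\sum_{n=1}^\infty\alpha_n=\infty$, then $(x_n)$ converges strongly to $z=\Pi_{(A+B)^{-1}(0)}(x_1)$.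 -/

import Mathlib

open Filter Topology

noncomputable section

namespace BanachTseng

variable {E : Type*} [NormedAddCommGroup E] [NormedSpace ℝ E]

/-- The modulus of convexity `δ_E(ε)`, the infimum of `1 - ‖(x + y) / 2‖` over `x, y` in the closed
unit ball with `‖x - y‖ ≥ ε`. It takes values in the extended reals, so that the infimum of the
empty set (which occurs only in the zero space) is `+∞`. -/
def modulusOfConvexity (E : Type*) [NormedAddCommGroup E] [NormedSpace ℝ E] (ε : ℝ) : EReal :=
  ⨅ (x : E) (y : E) (_ : ‖x‖ ≤ 1) (_ : ‖y‖ ≤ 1) (_ : ε ≤ ‖x - y‖),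
    ((1 - ‖(1 / 2 : ℝ) • (x + y)‖ : ℝ) : EReal)

/-- `E` is 2-uniformly convex: `δ_E(ε) ≥ c ε²` on `[0, 2]` for some `c > 0`. -/
def TwoUniformlyConvex (E : Type*) [NormedAddCommGroup E] [NormedSpace ℝ E] : Prop :=
  ∃ c : ℝ, 0 < c ∧ ∀ ε ∈ Set.Icc (0 : ℝ) 2, ((c * ε ^ 2 : ℝ) : EReal) ≤ modulusOfConvexity E ε

/-- `E` is uniformly smooth: the limit of `(‖x + t y‖ - ‖x‖) / t` as `t → 0`, `t ≠ 0`, exists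
uniformly in `x, y` in the unit sphere. -/
def UniformlySmooth (E : Type*) [NormedAddCommGroup E] [NormedSpace ℝ E] : Prop :=
  ∃ g : E × E → ℝ, TendstoUniformlyOn
    (fun (t : ℝ) (p : E × E) => (‖p.1 + t • p.2‖ - ‖p.1‖) / t) g (𝓝[≠] 0)
    (Metric.sphere 0 1 ×ˢ Metric.sphere 0 1)

/-- The values `f` of the (set-valued) normalized duality mapping at `x`:
`⟨f, x⟩ = ‖f‖² = ‖x‖²`. -/
def dualitySet (x : E) : Set (StrongDual ℝ E) :=
  {f | f x = ‖f‖ ^ 2 ∧ ‖f‖ ^ 2 = ‖x‖ ^ 2}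

theorem dualitySet_nonempty (x : E) : (dualitySet x).Nonempty := by
  obtain ⟨g, hg, hgx⟩ := exists_dual_vector'' ℝ x
  have hgx' : g x = ‖x‖ := by simpa using hgx
  rcases eq_or_ne x 0 with rfl | hx
  · exact ⟨0, by simp [dualitySet]⟩
  · have hx' : 0 < ‖x‖ := norm_pos_iff.mpr hx
    have h1 : ‖g‖ = 1 := by
      refine le_antisymm hg ?_
      have h := g.le_opNorm x
      rw [hgx', Real.norm_eq_abs, abs_of_pos hx'] at h
      nlinarith
    refine ⟨‖x‖ • g, ?_⟩
    have h2 : ‖‖x‖ • g‖ = ‖x‖ := by rw [norm_smul, h1, norm_norm, mul_one]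
    refine ⟨?_, by rw [h2]⟩
    rw [h2, smul_apply, hgx', smul_eq_mul, sq]

/-- The normalized duality mapping `J : E → E*` as a single-valued mapping. `dualitySet x` is never
empty, and it has exactly one element when `E` is smooth. -/
def dualityMap (x : E) : StrongDual ℝ E :=
  (dualitySet_nonempty x).choose

theorem dualityMap_mem (x : E) : dualityMap x ∈ dualitySet x :=
  (dualitySet_nonempty x).choose_spec

/-- The inverse `J⁻¹ : E* → E` of the normalized duality mapping. `J` is a bijection when `E` is
uniformly convex, uniformly smooth and complete. -/
def dualityInv (f : StrongDual ℝ E) : E :=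
  Function.invFun (dualityMap (E := E)) f

/-- The functional `φ(x, y) = ‖x‖² - 2⟨x, Jy⟩ + ‖y‖²`. -/
def lyapunov (x y : E) : ℝ :=
  ‖x‖ ^ 2 - 2 * dualityMap y x + ‖y‖ ^ 2

/-- `z` is a generalized projection of `x` onto `C`: a minimizer of `φ(·, x)` over `C`. -/
def IsGeneralizedProjection (C : Set E) (x z : E) : Prop :=
  z ∈ C ∧ ∀ y ∈ C, lyapunov z x ≤ lyapunov y x

/-- The 2-uniform convexity constant of `E`: the least `m ≥ 1` such that
`(‖x + y‖² + ‖x - y‖²) / 2 ≥ ‖x‖² + ‖m⁻¹ y‖²` for all `x, y`. -/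
def uniformConvexityConst (E : Type*) [NormedAddCommGroup E] [NormedSpace ℝ E] : ℝ :=
  sInf {m : ℝ | 1 ≤ m ∧ ∀ x y : E,
    ‖x‖ ^ 2 + ‖m⁻¹ • y‖ ^ 2 ≤ (‖x + y‖ ^ 2 + ‖x - y‖ ^ 2) / 2}

/-- The 2-uniform smoothness constant of `F`: the least `k > 0` such that
`‖x + y‖² ≤ ‖x‖² + 2⟨y, Jx⟩ + 2 k² ‖y‖²` for all `x, y` (and `0` if `F` is the zero space). -/
def uniformSmoothnessConst (F : Type*) [NormedAddCommGroup F] [NormedSpace ℝ F] : ℝ :=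
  sInf {k : ℝ | 0 < k ∧ ∀ x y : F,
    ‖x + y‖ ^ 2 ≤ ‖x‖ ^ 2 + 2 * dualityMap x y + 2 * k ^ 2 * ‖y‖ ^ 2}

/-- Monotonicity of a set-valued operator. -/
def IsMonotoneOperator (B : E → Set (StrongDual ℝ E)) : Prop :=
  ∀ x y : E, ∀ f ∈ B x, ∀ g ∈ B y, 0 ≤ (f - g) (x - y)

/-- Maximal monotonicity of a set-valued operator: its graph is not contained in that of another
monotone operator. -/
def IsMaximalMonotone (B : E → Set (StrongDual ℝ E)) : Prop :=
  IsMonotoneOperator B ∧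
    ∀ S : E → Set (StrongDual ℝ E), IsMonotoneOperator S → (∀ x, B x ⊆ S x) → B = S

/-- The solution set `(A + B)⁻¹(0)` of `0 ∈ Ax + Bx`. -/
def solutionSet (A : E → StrongDual ℝ E) (B : E → Set (StrongDual ℝ E)) : Set E :=
  {x | ∃ v ∈ B x, A x + v = 0}

/-- The resolvent `(J + rB)⁻¹ J` of `B`: the point `z` with `Jx ∈ Jz + r Bz`. For `r > 0` there is
exactly one such `z` when `B` is maximal monotone and `E` is reflexive, strictly convex and
smooth. -/
def resolvent (B : E → Set (StrongDual ℝ E)) (r : ℝ) (x : E) : E :=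
  Classical.epsilon fun z : E => ∃ v ∈ B z, dualityMap x = dualityMap z + r • v

end BanachTseng

end

/-! Let `c = μ⁻²`. Strong convexity of `‖·‖²` with constant `c` gives `c‖x - y‖² ≤ φ(x, y)`, makes
`J` surjective with a `1/c`-Lipschitz inverse, and makes `E` reflexive. Uniform smoothness makes `J`
single-valued and uniformly continuous on bounded sets.

If `p` is a zero of `A + B`, smoothness of the dual norm at `Jy` and monotonicity give `φ(p, w) ≤
φ(p, x) - φ(y, x) + 2κ²λ²‖Ay - Ax‖²` for one step (`lyapunov_le_forwardBackwardForward`). The error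
is at most `q²φ(y, x)` with `q = √2 μκLb < 1`, so a decrease `(1 - q²)φ(y, x)` survives.

Averaging with `Jx₁` yields `s (n + 1) ≤ (1 - α n) s n + α n β n` for `s n = φ(z, x n)`, where `β n`
keeps the decrease, divided by `α n`, with a minus sign. This avoids a case split on the
monotonicity of `s`: if `β n > ε` along an ultrafilter, then `φ(y n, x n) = O(α n)`, the gaps `y n -
x n` and `x (n + 1) - y n` vanish, the weak limit `p` of `y n` is a zero of `A + B`, and `ε ≤ 2⟨Jx₁
- Jz, p - z⟩ ≤ 0` by the variational inequality of the projection. Xu's lemma then gives `s n → 0`.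

Existence of resolvents and Minty's description of the zeros rest on Rockafellar's theorem
(`exists_neg_mem_dualitySet`), obtained by separating the epigraph of a Fitzpatrick function from a
concave quadratic. -/

namespace BanachTseng

/-! ### Strong convexity of the squared norm and its dual consequences. -/

section Geometry

variable {E : Type*} [NormedAddCommGroup E] [NormedSpace ℝ E]

/-- The square of the norm is strongly convex with constant `c`. -/
def StronglyConvexSq (E : Type*) [NormedAddCommGroup E] (c : ℝ) : Prop :=
  ∀ x y : E, ‖x‖ ^ 2 + c * ‖y‖ ^ 2 ≤ (‖x + y‖ ^ 2 + ‖x - y‖ ^ 2) / 2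

theorem StronglyConvexSq.midpoint {c : ℝ} (h : StronglyConvexSq E c) (x y : E) :
    ‖(1 / 2 : ℝ) • (x + y)‖ ^ 2 + c / 4 * ‖x - y‖ ^ 2 ≤ (‖x‖ ^ 2 + ‖y‖ ^ 2) / 2 := by
  have h1 := h ((1 / 2 : ℝ) • (x + y)) ((1 / 2 : ℝ) • (x - y))
  rw [show (1 / 2 : ℝ) • (x + y) + (1 / 2 : ℝ) • (x - y) = x by module,
    show (1 / 2 : ℝ) • (x + y) - (1 / 2 : ℝ) • (x - y) = y by module,
    norm_smul _ (x - y)] at h1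
  norm_num at h1 ⊢
  linarith

theorem TwoUniformlyConvex.exists_modulus (h : TwoUniformlyConvex E) :
    ∃ c : ℝ, 0 < c ∧ ∀ x y : E, ‖x‖ ≤ 1 → ‖y‖ ≤ 1 →
      c * ‖x - y‖ ^ 2 ≤ 1 - ‖(1 / 2 : ℝ) • (x + y)‖ := by
  obtain ⟨c, hc, h⟩ := h
  refine ⟨c, hc, fun x y hx hy => ?_⟩
  have h1 := h ‖x - y‖ ⟨norm_nonneg _, (norm_sub_le x y).trans (by linarith)⟩
  have h2 : modulusOfConvexity E ‖x - y‖ ≤ ((1 - ‖(1 / 2 : ℝ) • (x + y)‖ : ℝ) : EReal) :=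
    iInf_le_of_le x (iInf_le_of_le y (iInf_le_of_le hx (iInf_le_of_le hy (iInf_le_of_le le_rfl le_rfl))))
  exact EReal.coe_le_coe_iff.mp (h1.trans h2)

/-- The estimate behind `TwoUniformlyConvex.exists_midpoint`, for a unit vector `x` and a multiple
`s • y` of another one. -/
theorem midpoint_sq_of_modulus {c : ℝ} (hc : 0 < c)
    (h : ∀ x y : E, ‖x‖ ≤ 1 → ‖y‖ ≤ 1 → c * ‖x - y‖ ^ 2 ≤ 1 - ‖(1 / 2 : ℝ) • (x + y)‖)
    {x y : E} (hx : ‖x‖ = 1) (hy : ‖y‖ = 1) {s : ℝ} (hs0 : 0 ≤ s) (hs1 : s ≤ 1) :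
    ‖(1 / 2 : ℝ) • (x + s • y)‖ ^ 2 + min (1 / 4) c / 2 * ‖x - s • y‖ ^ 2 ≤ (1 + s ^ 2) / 2 := by
  have hd := h x y hx.le hy.le
  set δ := ‖x - y‖ with hδ
  have hδ0 : 0 ≤ δ := norm_nonneg _
  -- The modulus acts only on the common part `s • (x + y) / 2`; the excess `(1 - s) / 2 • x` is
  -- bounded by the triangle inequality.
  have h1 : ‖(1 / 2 : ℝ) • (x + s • y)‖ ≤ (1 + s) / 2 - s * (c * δ ^ 2) := by
    have e : (1 / 2 : ℝ) • (x + s • y) =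
        s • ((1 / 2 : ℝ) • (x + y)) + ((1 - s) / 2) • x := by module
    rw [e]
    refine (norm_add_le _ _).trans ?_
    rw [norm_smul, norm_smul ((1 - s) / 2), hx, Real.norm_of_nonneg hs0,
      Real.norm_of_nonneg (by linarith : 0 ≤ (1 - s) / 2)]
    nlinarith
  have h2 : ‖x - s • y‖ ≤ (1 - s) + s * δ := by
    have e : x - s • y = (1 - s) • x + s • (x - y) := by module
    rw [e]
    refine (norm_add_le _ _).trans ?_
    rw [norm_smul, norm_smul s, hx, Real.norm_of_nonneg hs0,
      Real.norm_of_nonneg (by linarith : 0 ≤ (1 - s)), mul_one]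
  have hcd : c * δ ^ 2 ≤ 1 := hd.trans (by linarith [norm_nonneg ((1 / 2 : ℝ) • (x + y))])
  have hcd0 : 0 ≤ c * δ ^ 2 := by positivity
  have h3 : ‖(1 / 2 : ℝ) • (x + s • y)‖ ^ 2 ≤ ((1 + s) / 2 - s * (c * δ ^ 2)) ^ 2 :=
    pow_le_pow_left₀ (norm_nonneg _) h1 2
  have h4 : ‖x - s • y‖ ^ 2 ≤ 2 * ((1 - s) ^ 2 + (s * δ) ^ 2) :=
    (pow_le_pow_left₀ (norm_nonneg _) h2 2).trans (by nlinarith [sq_nonneg ((1 - s) - s * δ)])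
  have hk0 : 0 ≤ min (1 / 4) c := le_min (by norm_num) hc.le
  -- The two terms on the right are the available gains: `(1 - s)² / 4` is the convexity gap of the
  -- square at `1` and `s`, and `s * (c * δ²)` comes from the modulus. This fixes the constant `min
  -- (1/4) c / 2`.
  have h5 : min (1 / 4) c / 2 * ‖x - s • y‖ ^ 2 ≤ (1 - s) ^ 2 / 4 + s * (c * δ ^ 2) := by
    have hs2 : s ^ 2 ≤ s := by nlinarith
    calc min (1 / 4) c / 2 * ‖x - s • y‖ ^ 2
        ≤ min (1 / 4) c / 2 * (2 * ((1 - s) ^ 2 + (s * δ) ^ 2)) := by gcongr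
      _ = min (1 / 4) c * (1 - s) ^ 2 + min (1 / 4) c * (s ^ 2 * δ ^ 2) := by ring
      _ ≤ 1 / 4 * (1 - s) ^ 2 + c * (s * δ ^ 2) := by
        gcongr
        · exact min_le_left _ _
        · exact min_le_right _ _
      _ = _ := by ring
  have h6 : 0 ≤ s * (c * δ ^ 2) * (s * (1 - c * δ ^ 2)) :=
    mul_nonneg (mul_nonneg hs0 hcd0) (mul_nonneg hs0 (by linarith))
  nlinarith

theorem TwoUniformlyConvex.exists_midpoint (h : TwoUniformlyConvex E) :
    ∃ c : ℝ, 0 < c ∧ ∀ x y : E,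
      ‖(1 / 2 : ℝ) • (x + y)‖ ^ 2 + c * ‖x - y‖ ^ 2 ≤ (‖x‖ ^ 2 + ‖y‖ ^ 2) / 2 := by
  obtain ⟨c, hc, h⟩ := h.exists_modulus
  have hk : 0 < min (1 / 4) c / 2 := by positivity
  have key : ∀ x y : E, ‖y‖ ≤ ‖x‖ → ‖(1 / 2 : ℝ) • (x + y)‖ ^ 2 +
      min (1 / 4) c / 2 * ‖x - y‖ ^ 2 ≤ (‖x‖ ^ 2 + ‖y‖ ^ 2) / 2 := by
    intro x y hyx
    rcases eq_or_ne y 0 with rfl | hy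
    · have : min (1 / 4) c / 2 ≤ 1 / 8 := by linarith [min_le_left (1 / 4) c]
      rw [add_zero, sub_zero, norm_smul, norm_zero]
      norm_num
      nlinarith [mul_le_mul_of_nonneg_right this (sq_nonneg ‖x‖)]
    have hy' : 0 < ‖y‖ := norm_pos_iff.mpr hy
    have hx' : 0 < ‖x‖ := hy'.trans_le hyx
    have h1 := midpoint_sq_of_modulus hc h (x := ‖x‖⁻¹ • x) (y := ‖y‖⁻¹ • y)
      (by rw [norm_smul, norm_inv, norm_norm, inv_mul_cancel₀ hx'.ne'])
      (by rw [norm_smul, norm_inv, norm_norm, inv_mul_cancel₀ hy'.ne'])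
      (s := ‖x‖⁻¹ * ‖y‖) (by positivity)
      (by rw [inv_mul_le_iff₀ hx']; linarith)
    have e1 : (‖x‖⁻¹ * ‖y‖) • ‖y‖⁻¹ • y = ‖x‖⁻¹ • y := by
      rw [smul_smul, mul_assoc, mul_inv_cancel₀ hy'.ne', mul_one]
    rw [e1, ← smul_add, ← smul_sub, smul_comm, norm_smul, norm_smul _ (x - y), norm_inv,
      norm_norm] at h1
    have h2 := mul_le_mul_of_nonneg_left h1 (sq_nonneg ‖x‖)
    field_simp at h2 ⊢
    linarith
  refine ⟨_, hk, fun x y => ?_⟩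
  rcases le_total ‖y‖ ‖x‖ with hxy | hxy
  · exact key x y hxy
  · have := key y x hxy
    rwa [add_comm y x, norm_sub_rev y x, add_comm (‖y‖ ^ 2)] at this

theorem TwoUniformlyConvex.exists_const (h : TwoUniformlyConvex E) :
    ∃ m : ℝ, 1 ≤ m ∧ ∀ x y : E,
      ‖x‖ ^ 2 + ‖m⁻¹ • y‖ ^ 2 ≤ (‖x + y‖ ^ 2 + ‖x - y‖ ^ 2) / 2 := by
  obtain ⟨c, hc, h⟩ := h.exists_midpoint
  -- Since `m ≥ 1` and `m⁻¹ ≤ 4c`, also `m⁻² ≤ 4c`, with no square root needed.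
  refine ⟨max 1 (4 * c)⁻¹, le_max_left _ _, fun x y => ?_⟩
  have h1 := h (x + y) (x - y)
  rw [show (1 / 2 : ℝ) • (x + y + (x - y)) = x by module,
    show (x + y) - (x - y) = (2 : ℝ) • y by module, norm_smul, mul_pow] at h1
  norm_num at h1
  set m := max 1 (4 * c)⁻¹
  have hm1 : 1 ≤ m := le_max_left _ _
  have hm2 : (4 * c)⁻¹ ≤ m := le_max_right _ _
  have hm3 : m⁻¹ ≤ 4 * c := inv_le_of_inv_le₀ (by positivity) hm2
  have hm4 : m⁻¹ ≤ 1 := inv_le_one_of_one_le₀ hm1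
  have hm0 : 0 ≤ m⁻¹ := by positivity
  have h2 : m⁻¹ ^ 2 ≤ 4 * c := by nlinarith
  rw [norm_smul, Real.norm_of_nonneg hm0, mul_pow]
  nlinarith [mul_le_mul_of_nonneg_right h2 (sq_nonneg ‖y‖)]

theorem TwoUniformlyConvex.uniformConvexityConst_mem (h : TwoUniformlyConvex E) :
    uniformConvexityConst E ∈ {m : ℝ | 1 ≤ m ∧ ∀ x y : E,
      ‖x‖ ^ 2 + ‖m⁻¹ • y‖ ^ 2 ≤ (‖x + y‖ ^ 2 + ‖x - y‖ ^ 2) / 2} := by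
  refine IsClosed.csInf_mem ?_ h.exists_const ⟨1, fun m hm => hm.1⟩
  -- Clearing the inverse leaves inequalities polynomial in `m`, so the set is visibly closed and
  -- the infimum is attained.
  have e : {m : ℝ | 1 ≤ m ∧ ∀ x y : E,
      ‖x‖ ^ 2 + ‖m⁻¹ • y‖ ^ 2 ≤ (‖x + y‖ ^ 2 + ‖x - y‖ ^ 2) / 2} =
      {m : ℝ | 1 ≤ m ∧ ∀ x y : E,
      m ^ 2 * ‖x‖ ^ 2 + ‖y‖ ^ 2 ≤ m ^ 2 * ((‖x + y‖ ^ 2 + ‖x - y‖ ^ 2) / 2)} := by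
    ext m
    refine and_congr_right fun hm => forall₂_congr fun x y => ?_
    have hm0 : 0 < m := by linarith
    rw [norm_smul, norm_inv, Real.norm_of_nonneg hm0.le, ← mul_le_mul_iff_of_pos_left (pow_pos hm0 2)]
    have : m ^ 2 * (‖x‖ ^ 2 + (m⁻¹ * ‖y‖) ^ 2) = m ^ 2 * ‖x‖ ^ 2 + ‖y‖ ^ 2 := by
      field_simp
    rw [this]
  rw [e]
  simp only [Set.ofPred_and, Set.ofPred_forall]
  refine isClosed_Ici.inter (isClosed_iInter fun x => isClosed_iInter fun y => ?_)
  exact isClosed_le (by fun_prop) (by fun_prop)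

theorem TwoUniformlyConvex.stronglyConvexSq (h : TwoUniformlyConvex E) :
    StronglyConvexSq E ((uniformConvexityConst E)⁻¹ ^ 2) := by
  intro x y
  have := h.uniformConvexityConst_mem.2 x y
  rwa [norm_smul, mul_pow, Real.norm_eq_abs, sq_abs] at this

theorem norm_of_mem_dualitySet {x : E} {f : StrongDual ℝ E} (h : f ∈ dualitySet x) :
    ‖f‖ = ‖x‖ :=
  (sq_eq_sq₀ (norm_nonneg _) (norm_nonneg _)).mp h.2

theorem apply_self_of_mem_dualitySet {x : E} {f : StrongDual ℝ E} (h : f ∈ dualitySet x) :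
    f x = ‖x‖ ^ 2 := h.1.trans h.2

theorem subgradient_of_mem_dualitySet {x : E} {f : StrongDual ℝ E} (h : f ∈ dualitySet x) (y : E) :
    ‖x‖ ^ 2 + 2 * f y ≤ ‖x + y‖ ^ 2 := by
  have h1 := (le_abs_self _).trans (f.le_opNorm (x + y))
  rw [map_add, apply_self_of_mem_dualitySet h, norm_of_mem_dualitySet h] at h1
  nlinarith [sq_nonneg (‖x + y‖ - ‖x‖)]

/-- A real number that is `O(t)` as `t → 0⁺` is nonpositive. -/
theorem nonpos_of_forall_le_mul {r K : ℝ} (h : ∀ t : ℝ, 0 < t → r ≤ t * K) : r ≤ 0 := by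
  have h1 : Tendsto (fun t : ℝ => t * K) (𝓝[>] 0) (𝓝 0) := by
    have : Tendsto (fun t : ℝ => t * K) (𝓝 0) (𝓝 (0 * K)) := (continuous_id.mul_const K).tendsto 0
    rw [zero_mul] at this
    exact this.mono_left nhdsWithin_le_nhds
  exact ge_of_tendsto h1 (eventually_nhdsWithin_of_forall h)

/-- The first-order terms of the inequality along `t • y` and along `-t • x`, as `t → 0⁺`, give `‖f‖
≤ ‖x‖` and `‖x‖² ≤ f x`. -/
theorem mem_dualitySet_of_subgradient {x : E} {f : StrongDual ℝ E}
    (h : ∀ y, ‖x‖ ^ 2 + 2 * f y ≤ ‖x + y‖ ^ 2) : f ∈ dualitySet x := by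
  have h1 : ∀ y, f y ≤ ‖x‖ * ‖y‖ := by
    intro y
    have : 2 * f y - 2 * (‖x‖ * ‖y‖) ≤ 0 := by
      refine nonpos_of_forall_le_mul (K := ‖y‖ ^ 2) fun t ht => ?_
      have h2 := h (t • y)
      have h3 : ‖x + t • y‖ ^ 2 ≤ (‖x‖ + t * ‖y‖) ^ 2 := by
        gcongr
        refine (norm_add_le _ _).trans ?_
        rw [norm_smul, Real.norm_of_nonneg ht.le]
      rw [map_smul, smul_eq_mul] at h2
      refine le_of_mul_le_mul_left ?_ ht
      linarith
    linarith
  have h2 : ‖f‖ ≤ ‖x‖ := by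
    refine f.opNorm_le_bound (norm_nonneg _) fun y => abs_le.mpr ⟨?_, h1 y⟩
    have := h1 (-y)
    rw [map_neg, norm_neg] at this
    linarith
  have h3 : ‖x‖ ^ 2 ≤ f x := by
    have : 2 * ‖x‖ ^ 2 - 2 * f x ≤ 0 := by
      refine nonpos_of_forall_le_mul (K := ‖x‖ ^ 2) fun t ht => ?_
      have h2 := h (-(t • x))
      have e : x + -(t • x) = (1 - t) • x := by module
      rw [e, norm_smul, mul_pow, Real.norm_eq_abs, sq_abs, map_neg, map_smul, smul_eq_mul] at h2
      refine le_of_mul_le_mul_left ?_ ht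
      linarith
    linarith
  have h4 := (le_abs_self _).trans (f.le_opNorm x)
  have h5 : ‖x‖ ≤ ‖f‖ := by
    rcases eq_or_ne x 0 with rfl | hx
    · simp
    · have : 0 < ‖x‖ := norm_pos_iff.mpr hx
      nlinarith
  have h6 : ‖f‖ = ‖x‖ := le_antisymm h2 h5
  rw [h6] at h4
  exact ⟨by rw [h6]; nlinarith, by rw [h6]⟩

theorem StronglyConvexSq.subgradient {c : ℝ} (hc : StronglyConvexSq E c) {x : E}
    {f : StrongDual ℝ E} (h : f ∈ dualitySet x) (y : E) :
    ‖x‖ ^ 2 + 2 * f y + c * ‖y‖ ^ 2 ≤ ‖x + y‖ ^ 2 := by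
  -- Bootstrapping by halving: the midpoint inequality for `x + y` and `x` improves the constant
  -- from `c(1 - 2⁻ⁿ)` to `c(1 - 2⁻ⁿ⁻¹)`, starting from the plain subgradient inequality.
  have key : ∀ n : ℕ, ∀ y : E,
      c * (1 - (1 / 2) ^ n) * ‖y‖ ^ 2 ≤ ‖x + y‖ ^ 2 - ‖x‖ ^ 2 - 2 * f y := by
    intro n
    induction n with
    | zero => intro y; have := subgradient_of_mem_dualitySet h y; simp; linarith
    | succ n ih =>
      intro y
      have h1 := ih ((1 / 2 : ℝ) • y)
      have h2 := hc.midpoint (x + y) x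
      rw [show (1 / 2 : ℝ) • (x + y + x) = x + (1 / 2 : ℝ) • y by module, add_sub_cancel_left] at h2
      rw [norm_smul, map_smul, smul_eq_mul] at h1
      norm_num at h1
      rw [pow_succ]
      norm_num at h2 ⊢
      nlinarith
  have h1 : Tendsto (fun n : ℕ => c * (1 - (1 / 2 : ℝ) ^ n) * ‖y‖ ^ 2) atTop
      (𝓝 (c * (1 - 0) * ‖y‖ ^ 2)) :=
    ((tendsto_const_nhds.sub (tendsto_pow_atTop_nhds_zero_of_lt_one (by norm_num)
      (by norm_num))).const_mul c).mul_const _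
  have h2 := le_of_tendsto' h1 fun n => key n y
  linarith

theorem StronglyConvexSq.monotone {c : ℝ} (hc : StronglyConvexSq E c) {x y : E}
    {f g : StrongDual ℝ E} (hf : f ∈ dualitySet x) (hg : g ∈ dualitySet y) :
    c * ‖x - y‖ ^ 2 ≤ (f - g) (x - y) := by
  have h1 := hc.subgradient hf (y - x)
  have h2 := hc.subgradient hg (x - y)
  rw [add_sub_cancel, norm_sub_rev, ← neg_sub x y, map_neg] at h1
  rw [add_sub_cancel] at h2
  rw [sub_apply]
  linarith

theorem StronglyConvexSq.norm_sub_le {c : ℝ} (hc : StronglyConvexSq E c) {x y : E}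
    {f g : StrongDual ℝ E} (hf : f ∈ dualitySet x) (hg : g ∈ dualitySet y) :
    c * ‖x - y‖ ≤ ‖f - g‖ := by
  have h1 := hc.monotone hf hg
  have h2 := (le_abs_self _).trans ((f - g).le_opNorm (x - y))
  rcases (norm_nonneg (x - y)).eq_or_lt with h0 | h0
  · rw [← h0]; simp
  · refine le_of_mul_le_mul_right ?_ h0
    nlinarith

/-- Strong convexity makes minimizing sequences Cauchy, so completeness replaces weak compactness.
The quadratic growth term later gives uniqueness of the projection. -/
theorem exists_minimizer [CompleteSpace E] {c : ℝ} (hc0 : 0 < c) (hc : StronglyConvexSq E c)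
    {C : Set E} (hne : C.Nonempty) (hcl : IsClosed C) (hcv : Convex ℝ C) (f : StrongDual ℝ E) :
    ∃ x ∈ C, ∀ y ∈ C, ‖x‖ ^ 2 - 2 * f x + c / 2 * ‖x - y‖ ^ 2 ≤ ‖y‖ ^ 2 - 2 * f y := by
  set q : E → ℝ := fun y => ‖y‖ ^ 2 - 2 * f y with hq
  have hbdd : BddBelow (q '' C) := by
    refine ⟨-‖f‖ ^ 2, ?_⟩
    rintro _ ⟨y, -, rfl⟩
    have := (le_abs_self _).trans (f.le_opNorm y)
    simp only [hq]
    nlinarith [sq_nonneg (‖f‖ - ‖y‖)]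
  set I := sInf (q '' C) with hI
  have hle : ∀ y ∈ C, I ≤ q y := fun y hy => csInf_le hbdd ⟨y, hy, rfl⟩
  have hpar : ∀ u ∈ C, ∀ v ∈ C, 2 * I + c / 2 * ‖u - v‖ ^ 2 ≤ q u + q v := by
    intro u hu v hv
    have h1 := hc.midpoint u v
    have h2 : (1 / 2 : ℝ) • (u + v) ∈ C := by
      rw [smul_add]
      exact hcv hu hv (by norm_num) (by norm_num) (by norm_num)
    have h3 := hle _ h2
    simp only [hq] at h3 ⊢
    rw [map_smul, map_add, smul_eq_mul] at h3
    linarith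
  have hseq : ∀ n : ℕ, ∃ u ∈ C, q u < I + 1 / ((n : ℝ) + 1) := by
    intro n
    obtain ⟨_, ⟨u, hu, rfl⟩, h⟩ := exists_lt_of_csInf_lt (hne.image q)
      (lt_add_of_pos_right I (by positivity : 0 < 1 / ((n : ℝ) + 1)))
    exact ⟨u, hu, h⟩
  choose u huC hu using hseq
  have hcau : CauchySeq u := by
    refine cauchySeq_of_le_tendsto_0 (fun N : ℕ => Real.sqrt (4 / c * (1 / ((N : ℝ) + 1)))) ?_ ?_
    · intro n m N hn hm
      rw [dist_eq_norm]
      refine Real.le_sqrt_of_sq_le ?_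
      have h1 := hpar _ (huC n) _ (huC m)
      have h2 := (hu n).le.trans (add_le_add le_rfl (Nat.one_div_le_one_div (α := ℝ) hn))
      have h3 := (hu m).le.trans (add_le_add le_rfl (Nat.one_div_le_one_div (α := ℝ) hm))
      rw [div_mul_eq_mul_div, le_div_iff₀ hc0]
      nlinarith
    · have h1 := (tendsto_one_div_add_atTop_nhds_zero_nat (𝕜 := ℝ)).const_mul (4 / c)
      have h2 := (Real.continuous_sqrt.tendsto _).comp h1
      simpa [Function.comp_def] using h2
  obtain ⟨x, hx⟩ := cauchySeq_tendsto_of_complete hcau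
  have hxC : x ∈ C := hcl.mem_of_tendsto hx (Eventually.of_forall huC)
  have hqc : Continuous q := by fun_prop
  have hqx : q x ≤ I := by
    have h1 : Tendsto (fun n : ℕ => I + 1 / ((n : ℝ) + 1)) atTop (𝓝 (I + 0)) :=
      tendsto_const_nhds.add tendsto_one_div_add_atTop_nhds_zero_nat
    rw [add_zero] at h1
    exact le_of_tendsto_of_tendsto' ((hqc.tendsto x).comp hx) h1 fun n => (hu n).le
  refine ⟨x, hxC, fun y hy => ?_⟩
  have h1 := hpar x hxC y hy
  simp only [hq] at h1 hqx ⊢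
  linarith

theorem exists_mem_dualitySet [CompleteSpace E] {c : ℝ} (hc0 : 0 < c) (hc : StronglyConvexSq E c)
    (f : StrongDual ℝ E) : ∃ x, f ∈ dualitySet x := by
  obtain ⟨x, -, hx⟩ := exists_minimizer hc0 hc Set.univ_nonempty isClosed_univ convex_univ f
  refine ⟨x, mem_dualitySet_of_subgradient fun y => ?_⟩
  have h1 := hx (x + y) (Set.mem_univ _)
  have h2 : 0 ≤ c / 2 * ‖x - (x + y)‖ ^ 2 := by positivity
  rw [map_add] at h1
  linarith

/-- Convexity of the dual norm squared bounds the increment by `2 * g z`, where `f + g ∈ dualitySet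
z`; replacing `z` by `x` costs `2‖g‖²/c`, because the inverse duality mapping is `1/c`-Lipschitz. -/
theorem norm_add_sq_le_dual [CompleteSpace E] {c : ℝ} (hc0 : 0 < c) (hc : StronglyConvexSq E c)
    {x : E} {f : StrongDual ℝ E} (hf : f ∈ dualitySet x) (g : StrongDual ℝ E) :
    ‖f + g‖ ^ 2 ≤ ‖f‖ ^ 2 + 2 * g x + 2 / c * ‖g‖ ^ 2 := by
  obtain ⟨z, hz⟩ := exists_mem_dualitySet hc0 hc (f + g)
  have h1 := hc.norm_sub_le hz hf
  rw [add_sub_cancel_left] at h1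
  have h2 := (le_abs_self _).trans (g.le_opNorm (z - x))
  have h3 : ‖g‖ * ‖z - x‖ ≤ ‖g‖ ^ 2 / c := by
    rw [le_div_iff₀ hc0]
    nlinarith [norm_nonneg g]
  have h4 : ‖f + g‖ ^ 2 - 2 * g z ≤ ‖f‖ ^ 2 := by
    have h5 := (le_abs_self _).trans (f.le_opNorm z)
    have h6 : (f + g) z = ‖f + g‖ ^ 2 := hz.1
    have h7 := norm_of_mem_dualitySet hz
    rw [add_apply] at h6
    rw [← h7] at h5
    nlinarith [sq_nonneg (‖f‖ - ‖f + g‖)]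
  rw [map_sub] at h2
  have : 2 / c * ‖g‖ ^ 2 = 2 * (‖g‖ ^ 2 / c) := by ring
  linarith

/-- The dual norm squared is differentiable at `f` with derivative `2x`, so the duality mapping of
the dual can only be evaluation at `x`. -/
theorem bidual_apply_eq [CompleteSpace E] {c : ℝ} (hc0 : 0 < c) (hc : StronglyConvexSq E c)
    {x : E} {f : StrongDual ℝ E} (hf : f ∈ dualitySet x) {F : StrongDual ℝ (StrongDual ℝ E)}
    (hF : F ∈ dualitySet f) (g : StrongDual ℝ E) : F g = g x := by
  have key : ∀ g, F g ≤ g x := by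
    intro g
    have : 2 * (F g - g x) ≤ 0 := by
      refine nonpos_of_forall_le_mul (K := 2 / c * ‖g‖ ^ 2) fun t ht => ?_
      have h1 := norm_add_sq_le_dual hc0 hc hf (t • g)
      have h2 := subgradient_of_mem_dualitySet hF (t • g)
      rw [map_smul, smul_eq_mul] at h2
      rw [smul_apply, smul_eq_mul, norm_smul, Real.norm_of_nonneg ht.le] at h1
      refine le_of_mul_le_mul_left ?_ ht
      linarith
    linarith
  refine le_antisymm (key g) ?_
  have := key (-g)
  rw [map_neg, neg_apply] at this
  linarith

theorem norm_add_sq_le_uniformSmoothnessConst [CompleteSpace E] {c : ℝ} (hc0 : 0 < c)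
    (hc : StronglyConvexSq E c) {x : E} {f : StrongDual ℝ E} (hf : f ∈ dualitySet x)
    (g : StrongDual ℝ E) :
    ‖f + g‖ ^ 2 ≤ ‖f‖ ^ 2 + 2 * g x +
      2 * uniformSmoothnessConst (StrongDual ℝ E) ^ 2 * ‖g‖ ^ 2 := by
  set K := {k : ℝ | 0 < k ∧ ∀ x y : StrongDual ℝ E,
    ‖x + y‖ ^ 2 ≤ ‖x‖ ^ 2 + 2 * dualityMap x y + 2 * k ^ 2 * ‖y‖ ^ 2} with hK
  have hne : K.Nonempty := by
    refine ⟨Real.sqrt (1 / c), by positivity, fun f g => ?_⟩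
    obtain ⟨x, hx⟩ := exists_mem_dualitySet hc0 hc f
    rw [bidual_apply_eq hc0 hc hx (dualityMap_mem f), Real.sq_sqrt (by positivity)]
    have := norm_add_sq_le_dual hc0 hc hx g
    rwa [mul_one_div]
  -- The infimum need not lie in `K` (for the zero space it is `0`); a limit of admissible constants
  -- suffices.
  have hmem : sInf K ∈ closure K := csInf_mem_closure hne ⟨0, fun k hk => hk.1.le⟩
  have hcl : IsClosed {k : ℝ | ‖f + g‖ ^ 2 ≤ ‖f‖ ^ 2 + 2 * g x + 2 * k ^ 2 * ‖g‖ ^ 2} :=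
    isClosed_le (by fun_prop) (by fun_prop)
  refine closure_minimal (fun k hk => ?_) hcl hmem
  have := hk.2 f g
  rwa [bidual_apply_eq hc0 hc hf (dualityMap_mem f)] at this

theorem uniformSmoothnessConst_nonneg (F : Type*) [NormedAddCommGroup F] [NormedSpace ℝ F] :
    0 ≤ uniformSmoothnessConst F :=
  Real.sInf_nonneg fun _ hk => hk.1.le

/-- A complete space whose squared norm is strongly convex is reflexive. -/
theorem StronglyConvexSq.reflexive [CompleteSpace E] {c : ℝ} (hc0 : 0 < c)
    (hc : StronglyConvexSq E c) (F : StrongDual ℝ (StrongDual ℝ E)) :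
    ∃ x : E, ∀ f : StrongDual ℝ E, F f = f x := by
  set i := NormedSpace.inclusionInDoubleDualLi ℝ (E := E) with hi
  suffices hF : ∀ ε > 0, ∃ b ∈ Set.range i, dist F b < ε by
    have hclosed := i.isometry.isUniformInducing.isComplete_range.isClosed
    have hmem := Metric.mem_closure_iff.mpr hF
    rw [hclosed.closure_eq] at hmem
    obtain ⟨x, hx⟩ := hmem
    exact ⟨x, fun f => by rw [← hx]; rfl⟩
  have hbdd : BddBelow (Set.range fun f : StrongDual ℝ E => ‖f‖ ^ 2 - 2 * F f) := by
    refine ⟨-‖F‖ ^ 2, ?_⟩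
    rintro _ ⟨f, rfl⟩
    have := (le_abs_self _).trans (F.le_opNorm f)
    simp only
    nlinarith [sq_nonneg (‖F‖ - ‖f‖)]
  -- An `ε²`-minimizer `f` of `‖f‖² - 2 F f` is nearly critical, and the derivative of `‖·‖²` at `f`
  -- is `2x`; hence `F` is close to evaluation at `x`. Testing with `g` of norm `ε` balances the
  -- error `ε²` against the quadratic term.
  have key : ∀ ε : ℝ, 0 < ε → ∃ x : E, ‖F - i x‖ ≤ ε * (1 / 2 + 1 / c) := by
    intro ε hε
    obtain ⟨_, ⟨f, rfl⟩, hf⟩ := exists_lt_of_csInf_lt (Set.range_nonempty _)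
      (lt_add_of_pos_right (sInf (Set.range fun f : StrongDual ℝ E => ‖f‖ ^ 2 - 2 * F f))
        (by positivity : 0 < ε ^ 2))
    obtain ⟨x, hx⟩ := exists_mem_dualitySet hc0 hc f
    refine ⟨x, ?_⟩
    have h1 : ∀ g : StrongDual ℝ E, 2 * (F - i x) g ≤ ε ^ 2 + 2 / c * ‖g‖ ^ 2 := by
      intro g
      have h2 := norm_add_sq_le_dual hc0 hc hx g
      have h3 := csInf_le hbdd ⟨f + g, rfl⟩
      simp only [map_add] at h3 hf
      have h4 : (F - i x) g = F g - g x := rfl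
      rw [h4]
      linarith
    have h5 : ∀ g : StrongDual ℝ E, (F - i x) g ≤ ε * (1 / 2 + 1 / c) * ‖g‖ := by
      intro g
      rcases eq_or_ne g 0 with rfl | hg
      · simp
      have hg' : 0 < ‖g‖ := norm_pos_iff.mpr hg
      have h6 := h1 ((ε / ‖g‖) • g)
      rw [map_smul, norm_smul, smul_eq_mul, norm_div, norm_norm, Real.norm_of_nonneg hε.le,
        div_mul_cancel₀ _ hg'.ne'] at h6
      have h7 : ε / ‖g‖ * (F - i x) g ≤ ε / ‖g‖ * (ε * (1 / 2 + 1 / c) * ‖g‖) := by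
        have : ε / ‖g‖ * (ε * (1 / 2 + 1 / c) * ‖g‖) = (ε ^ 2 + 2 / c * ε ^ 2) / 2 := by
          field_simp
        linarith
      exact le_of_mul_le_mul_left h7 (by positivity)
    refine (F - i x).opNorm_le_bound (by positivity) fun g => abs_le.mpr ⟨?_, h5 g⟩
    have := h5 (-g)
    rw [map_neg, norm_neg] at this
    linarith
  intro ε hε
  obtain ⟨x, hx⟩ := key (ε / (2 * (1 / 2 + 1 / c))) (by positivity)
  refine ⟨i x, ⟨x, rfl⟩, (dist_eq_norm F (i x)).trans_lt ?_⟩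
  have : ε / (2 * (1 / 2 + 1 / c)) * (1 / 2 + 1 / c) = ε / 2 := by field_simp
  linarith

end Geometry

/-! ### Uniform smoothness, continuity of the duality mapping, weak limits. -/

section DualityMap

variable {E : Type*} [NormedAddCommGroup E] [NormedSpace ℝ E]

theorem smul_mem_dualitySet {x : E} {f : StrongDual ℝ E} (h : f ∈ dualitySet x) (s : ℝ) :
    s • f ∈ dualitySet (s • x) := by
  refine ⟨?_, ?_⟩
  · rw [map_smul, smul_apply, smul_eq_mul, smul_eq_mul, h.1, norm_smul, mul_pow, Real.norm_eq_abs,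
      sq_abs]
    ring
  · rw [norm_smul, norm_smul, mul_pow, mul_pow, h.2]

theorem one_add_le_norm_add {x : E} {f : StrongDual ℝ E} (h : f ∈ dualitySet x) (hx : ‖x‖ = 1)
    (y : E) : 1 + f y ≤ ‖x + y‖ := by
  have h1 := (le_abs_self _).trans (f.le_opNorm (x + y))
  rw [map_add, apply_self_of_mem_dualitySet h, norm_of_mem_dualitySet h, hx] at h1
  linarith

theorem norm_inv_norm_smul {x : E} (hx : x ≠ 0) : ‖‖x‖⁻¹ • x‖ = 1 := by
  rw [norm_smul, norm_inv, norm_norm, inv_mul_cancel₀ (norm_ne_zero_iff.mpr hx)]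

theorem UniformlySmooth.eq_of_mem_dualitySet (hE : UniformlySmooth E) {x : E}
    {f g : StrongDual ℝ E} (hf : f ∈ dualitySet x) (hg : g ∈ dualitySet x) : f = g := by
  obtain ⟨G, hG⟩ := hE
  -- The value `f y` lies between the left and right difference quotients of the norm, which share
  -- one limit.
  have unit : ∀ x : E, ‖x‖ = 1 → ∀ f ∈ dualitySet x, ∀ y : E, ‖y‖ = 1 → f y = G (x, y) := by
    intro x hx f hf y hy
    have h1 := hG.tendsto_at (x := (x, y)) ⟨by simpa using hx, by simpa using hy⟩
    have h2 := h1.mono_left (nhdsGT_le_nhdsNE (0 : ℝ))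
    have h3 := h1.mono_left (nhdsLT_le_nhdsNE (0 : ℝ))
    have h4 : ∀ t : ℝ, 1 + t * f y ≤ ‖x + t • y‖ := by
      intro t
      have := one_add_le_norm_add hf hx (t • y)
      rwa [map_smul, smul_eq_mul] at this
    refine le_antisymm (ge_of_tendsto h2 ?_) (le_of_tendsto h3 ?_)
    · refine eventually_nhdsWithin_of_forall fun t (ht : 0 < t) => ?_
      simp only [hx]
      rw [le_div_iff₀ ht]
      linarith [h4 t]
    · refine eventually_nhdsWithin_of_forall fun t (ht : t < 0) => ?_
      simp only [hx]
      rw [div_le_iff_of_neg ht]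
      linarith [h4 t]
  rcases eq_or_ne x 0 with rfl | hx
  · have h1 := norm_of_mem_dualitySet hf
    have h2 := norm_of_mem_dualitySet hg
    rw [norm_zero, norm_eq_zero] at h1 h2
    rw [h1, h2]
  ext y
  rcases eq_or_ne y 0 with rfl | hy
  · simp
  have h1 := unit _ (norm_inv_norm_smul hx) _ (smul_mem_dualitySet hf ‖x‖⁻¹) _
    (norm_inv_norm_smul hy)
  have h2 := unit _ (norm_inv_norm_smul hx) _ (smul_mem_dualitySet hg ‖x‖⁻¹) _
    (norm_inv_norm_smul hy)
  have h3 := h1.trans h2.symm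
  have hx' : ‖x‖ ≠ 0 := norm_ne_zero_iff.mpr hx
  have hy' : ‖y‖ ≠ 0 := norm_ne_zero_iff.mpr hy
  simpa [hx', hy'] using h3

theorem UniformlySmooth.norm_add_le_one_add (hE : UniformlySmooth E) {ε : ℝ} (hε : 0 < ε) :
    ∃ δ > 0, ∀ x y : E, ∀ f ∈ dualitySet x, ‖x‖ = 1 → ‖y‖ < δ → ‖x + y‖ ≤ 1 + f y + ε * ‖y‖ := by
  have hE' := hE
  obtain ⟨G, hG⟩ := hE'
  have hG1 := Metric.tendstoUniformlyOn_iff.mp hG (ε / 2) (by positivity)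
  obtain ⟨δ, hδ, h⟩ := Metric.mem_nhdsWithin_iff.mp hG1
  refine ⟨δ, hδ, fun x y f hf hx hyδ => ?_⟩
  rcases eq_or_ne y 0 with rfl | hy
  · simp [hx]
  have hy' : 0 < ‖y‖ := norm_pos_iff.mpr hy
  set d := ‖y‖⁻¹ • y with hd
  have hd1 : ‖d‖ = 1 := norm_inv_norm_smul hy
  have hyd : y = ‖y‖ • d := by rw [hd, smul_smul, mul_inv_cancel₀ hy'.ne', one_smul]
  have key : ∀ t : ℝ, t ≠ 0 → |t| < δ → |G (x, d) - (‖x + t • d‖ - 1) / t| < ε / 2 := by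
    intro t ht0 ht
    have := h (show t ∈ Metric.ball (0 : ℝ) δ ∩ {0}ᶜ from ⟨by simpa using ht, ht0⟩) (x, d)
      ⟨by simpa using hx, by simpa using hd1⟩
    simpa [hx, Real.dist_eq] using this
  have h1 := key ‖y‖ hy'.ne' (by rwa [abs_of_pos hy'])
  -- The quotient at `-‖y‖` lies below `f d`, so both quotients being `ε / 2`-close to `G` bounds
  -- the forward one by `f d + ε`.
  have h2 := key (-‖y‖) (by linarith [hy'] : -‖y‖ < 0).ne (by rwa [abs_neg, abs_of_pos hy'])
  rw [← hyd] at h1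
  have h3 : (‖x + (-‖y‖) • d‖ - 1) / (-‖y‖) ≤ f d := by
    rw [div_le_iff_of_neg (by linarith)]
    have := one_add_le_norm_add hf hx ((-‖y‖) • d)
    rw [map_smul, smul_eq_mul] at this
    linarith
  have h4 : (‖x + y‖ - 1) / ‖y‖ ≤ f d + ε := by
    linarith [(abs_lt.mp h1).1, (abs_lt.mp h2).2]
  rw [div_le_iff₀ hy'] at h4
  have h5 : f y = f d * ‖y‖ := by
    conv_lhs => rw [hyd]
    rw [map_smul, smul_eq_mul, mul_comm]
  linarith

theorem UniformlySmooth.norm_sub_le_sphere (hE : UniformlySmooth E) {ε : ℝ} (hε : 0 < ε) :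
    ∃ δ > 0, ∀ x u : E, ∀ f ∈ dualitySet x, ∀ g ∈ dualitySet u, ‖x‖ = 1 → ‖u‖ = 1 →
      ‖u - x‖ < δ → ‖g - f‖ ≤ ε := by
  obtain ⟨δ, hδ, h⟩ := hE.norm_add_le_one_add (half_pos hε)
  refine ⟨δ / 3, by positivity, fun x u f hf g hg hx hu hxu => ?_⟩
  have key : ∀ d : E, (g - f) d ≤ ε * ‖d‖ := by
    intro d
    rcases eq_or_ne d 0 with rfl | hd
    · simp
    have hd' : 0 < ‖d‖ := norm_pos_iff.mpr hd
    set s := δ / 3 / ‖d‖ with hs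
    have hs0 : 0 < s := by positivity
    have hsd : ‖s • d‖ = δ / 3 := by
      rw [norm_smul, Real.norm_of_nonneg hs0.le, hs, div_mul_cancel₀ _ hd'.ne']
    have h1 : ‖(u - x) + s • d‖ ≤ 2 * (δ / 3) := by
      refine (norm_add_le _ _).trans ?_
      rw [hsd]
      linarith
    -- Compare the upper expansion at `x` with the lower one at `u`, at the same point `u + s • d`;
    -- the leftover `f (u - x)` is nonpositive for unit vectors.
    have h2 := h x ((u - x) + s • d) f hf hx (by linarith)
    have h3 := one_add_le_norm_add hg hu (s • d)
    rw [show x + ((u - x) + s • d) = u + s • d by abel] at h2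
    have h4 : f (u - x) ≤ 0 := by
      have h5 := (le_abs_self _).trans (f.le_opNorm u)
      rw [norm_of_mem_dualitySet hf, hx, hu] at h5
      rw [map_sub, apply_self_of_mem_dualitySet hf, hx]
      linarith
    rw [map_add, map_smul, smul_eq_mul] at h2
    rw [map_smul, smul_eq_mul] at h3
    have h6 : s * ‖d‖ = δ / 3 := by rw [hs, div_mul_cancel₀ _ hd'.ne']
    rw [sub_apply]
    refine le_of_mul_le_mul_left ?_ hs0
    nlinarith
  refine (g - f).opNorm_le_bound hε.le fun d => abs_le.mpr ⟨?_, key d⟩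
  have := key (-d)
  rw [map_neg, norm_neg] at this
  linarith

/-- The duality mapping of a uniformly smooth space is uniformly continuous on bounded sets. -/
theorem UniformlySmooth.norm_sub_le_of_norm_le (hE : UniformlySmooth E) (R : ℝ) {ε : ℝ} (hε : 0 < ε) :
    ∃ δ > 0, ∀ x u : E, ∀ f ∈ dualitySet x, ∀ g ∈ dualitySet u, ‖x‖ ≤ R →
      ‖u - x‖ < δ → ‖g - f‖ ≤ ε := by
  obtain ⟨δ, hδ, h⟩ := hE.norm_sub_le_sphere (ε := ε / (2 * (|R| + 1))) (by positivity)
  refine ⟨min (ε / 8) (ε * δ / 12), by positivity, fun x u f hf g hg hxR hux => ?_⟩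
  have hux1 : ‖u - x‖ < ε / 8 := hux.trans_le (min_le_left _ _)
  have hux2 : ‖u - x‖ < ε * δ / 12 := hux.trans_le (min_le_right _ _)
  have hn : |‖u‖ - ‖x‖| ≤ ‖u - x‖ := abs_norm_sub_norm_le u x
  rcases le_or_gt ‖x‖ (ε / 4) with hx | hx
  · refine (norm_sub_le g f).trans ?_
    rw [norm_of_mem_dualitySet hf, norm_of_mem_dualitySet hg]
    linarith [(abs_le.mp hn).2]
  have hx0 : 0 < ‖x‖ := by linarith
  have hu0 : 0 < ‖u‖ := by linarith [(abs_le.mp hn).1]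
  have hxne : x ≠ 0 := norm_pos_iff.mp hx0
  have hune : u ≠ 0 := norm_pos_iff.mp hu0
  have h1 := smul_mem_dualitySet hf ‖x‖⁻¹
  have h2 := smul_mem_dualitySet hg ‖u‖⁻¹
  have h3 : ‖‖u‖⁻¹ • u - ‖x‖⁻¹ • x‖ < δ := by
    have e : ‖u‖⁻¹ • u - ‖x‖⁻¹ • x =
        ‖x‖⁻¹ • (u - x) + (‖x‖⁻¹ * (‖x‖ - ‖u‖)) • (‖u‖⁻¹ • u) := by
      rw [smul_smul]
      have : ‖x‖⁻¹ * (‖x‖ - ‖u‖) * ‖u‖⁻¹ = ‖u‖⁻¹ - ‖x‖⁻¹ := by field_simp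
      rw [this]
      module
    have h4 : ‖‖u‖⁻¹ • u - ‖x‖⁻¹ • x‖ ≤ ‖x‖⁻¹ * ‖u - x‖ + ‖x‖⁻¹ * ‖u - x‖ := by
      rw [e]
      refine (norm_add_le _ _).trans (add_le_add ?_ ?_)
      · rw [norm_smul, norm_inv, norm_norm]
      · rw [norm_smul, norm_inv_norm_smul hune, mul_one, norm_mul, norm_inv, norm_norm,
          Real.norm_eq_abs, abs_sub_comm]
        gcongr
    refine h4.trans_lt ?_
    have h5 : ‖x‖⁻¹ * ‖u - x‖ < δ / 2 := by
      rw [inv_mul_lt_iff₀ hx0]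
      nlinarith
    linarith
  have h4 := h _ _ _ h1 _ h2 (norm_inv_norm_smul hxne) (norm_inv_norm_smul hune) h3
  have e : g - f = (‖u‖ - ‖x‖) • (‖u‖⁻¹ • g) + ‖x‖ • (‖u‖⁻¹ • g - ‖x‖⁻¹ • f) := by
    rw [smul_sub, smul_smul, smul_smul, smul_smul, mul_inv_cancel₀ hx0.ne', sub_mul,
      mul_inv_cancel₀ hu0.ne']
    module
  rw [e]
  refine (norm_add_le _ _).trans ?_
  rw [norm_smul, norm_smul ‖x‖, norm_norm, Real.norm_eq_abs, norm_of_mem_dualitySet h2,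
    norm_inv_norm_smul hune, mul_one]
  have h5 : ‖x‖ * ‖‖u‖⁻¹ • g - ‖x‖⁻¹ • f‖ ≤ (|R| + 1) * (ε / (2 * (|R| + 1))) := by
    gcongr
    linarith [le_abs_self R]
  have h6 : (|R| + 1) * (ε / (2 * (|R| + 1))) = ε / 2 := by
    have : |R| + 1 ≠ 0 := by positivity
    field_simp
  linarith

theorem UniformlySmooth.tendsto_norm_dualityMap_sub (hE : UniformlySmooth E) {ι : Type*}
    {l : Filter ι} {x u : ι → E} {R : ℝ} (hR : ∀ᶠ i in l, ‖x i‖ ≤ R)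
    (h : Tendsto (fun i => ‖u i - x i‖) l (𝓝 0)) :
    Tendsto (fun i => ‖dualityMap (u i) - dualityMap (x i)‖) l (𝓝 0) := by
  rw [Metric.tendsto_nhds] at h ⊢
  intro ε hε
  obtain ⟨δ, hδ, hd⟩ := hE.norm_sub_le_of_norm_le R (half_pos hε)
  filter_upwards [hR, h δ hδ] with i h1 h2
  rw [dist_zero_right, norm_norm] at h2 ⊢
  linarith [hd _ _ _ (dualityMap_mem (x i)) _ (dualityMap_mem (u i)) h1 h2]

theorem dualityMap_dualityInv [CompleteSpace E] {c : ℝ} (hc0 : 0 < c) (hc : StronglyConvexSq E c)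
    (hE : UniformlySmooth E) (f : StrongDual ℝ E) : dualityMap (dualityInv f) = f := by
  refine Function.invFun_eq ?_
  obtain ⟨x, hx⟩ := exists_mem_dualitySet hc0 hc f
  exact ⟨x, hE.eq_of_mem_dualitySet (dualityMap_mem x) hx⟩

/-- Bounded families in a reflexive space converge weakly along ultrafilters. -/
theorem exists_weak_limit (hrefl : ∀ F : StrongDual ℝ (StrongDual ℝ E), ∃ x : E, ∀ f, F f = f x)
    {ι : Type*} (U : Ultrafilter ι) {u : ι → E} {R : ℝ} (hR : ∀ᶠ i in (U : Filter ι), ‖u i‖ ≤ R) :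
    ∃ p : E, ∀ f : StrongDual ℝ E, Tendsto (fun i => f (u i)) U (𝓝 (f p)) := by
  set v : ι → WeakDual ℝ (StrongDual ℝ E) := fun i =>
    StrongDual.toWeakDual (NormedSpace.inclusionInDoubleDual ℝ E (u i)) with hv
  have hmem : ∀ᶠ i in (U : Filter ι), v i ∈ WeakDual.toStrongDual ⁻¹'
      Metric.closedBall (0 : StrongDual ℝ (StrongDual ℝ E)) R := by
    filter_upwards [hR] with i hi
    simp only [hv, Set.mem_preimage]
    exact (mem_closedBall_zero_iff (E := StrongDual ℝ (StrongDual ℝ E))).mpr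
      ((NormedSpace.double_dual_bound ℝ E (u i)).trans hi)
  obtain ⟨F, -, hF⟩ := (WeakDual.isCompact_closedBall (0 : StrongDual ℝ (StrongDual ℝ E))
    R).ultrafilter_le_nhds (U.map v) (le_principal_iff.mpr hmem)
  obtain ⟨p, hp⟩ := hrefl (WeakDual.toStrongDual F)
  refine ⟨p, fun f => ?_⟩
  have h1 : Tendsto v U (𝓝 F) := hF
  have h2 := (WeakDual.eval_continuous f).tendsto F |>.comp h1
  rw [← hp f]
  exact h2

end DualityMap

/-! ### Rockafellar surjectivity and Minty's characterization. -/

section MonotoneOperators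

variable {E : Type*} [NormedAddCommGroup E] [NormedSpace ℝ E]

theorem norm_sq_convex_combination {F : Type*} [NormedAddCommGroup F] [NormedSpace ℝ F] (x y : F)
    {a b : ℝ} (ha : 0 ≤ a) (hb : 0 ≤ b) (hab : a + b = 1) :
    ‖a • x + b • y‖ ^ 2 ≤ a * ‖x‖ ^ 2 + b * ‖y‖ ^ 2 := by
  have h1 : ‖a • x + b • y‖ ≤ a * ‖x‖ + b * ‖y‖ := by
    refine (norm_add_le _ _).trans ?_
    rw [norm_smul, norm_smul, Real.norm_of_nonneg ha, Real.norm_of_nonneg hb]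
  have h2 := pow_le_pow_left₀ (norm_nonneg _) h1 2
  have h3 := mul_nonneg (mul_nonneg ha hb) (sq_nonneg (‖x‖ - ‖y‖))
  obtain rfl : b = 1 - a := by linarith
  nlinarith

/-- Rockafellar's surjectivity theorem: the graph `G` of a maximal monotone operator on a reflexive
space contains a point `(x, f)` with `-f` in the duality set of `x`. -/
theorem exists_neg_mem_dualitySet
    (hrefl : ∀ F : StrongDual ℝ (StrongDual ℝ E), ∃ x : E, ∀ f, F f = f x)
    (hsurj : ∀ f : StrongDual ℝ E, ∃ x, f ∈ dualitySet x)
    {G : Set (E × StrongDual ℝ E)} (hne : G.Nonempty)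
    (hmono : ∀ p ∈ G, ∀ q ∈ G, 0 ≤ (p.2 - q.2) (p.1 - q.1))
    (hmax : ∀ p, (∀ q ∈ G, 0 ≤ (p.2 - q.2) (p.1 - q.1)) → p ∈ G) :
    ∃ p ∈ G, -p.2 ∈ dualitySet p.1 := by
  -- `S` is the epigraph of the Fitzpatrick function of `G`, and `K` is the strict hypograph of
  -- `-(‖x‖² + ‖f‖²) / 2`.
  set K : Set ((E × StrongDual ℝ E) × ℝ) :=
    {q | q.2 + (‖q.1.1‖ ^ 2 + ‖q.1.2‖ ^ 2) / 2 < 0} with hK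
  set S : Set ((E × StrongDual ℝ E) × ℝ) :=
    {q | ∀ p ∈ G, p.2 q.1.1 + q.1.2 p.1 - p.2 p.1 ≤ q.2} with hS
  have hKo : IsOpen K := isOpen_lt (by fun_prop) continuous_const
  have hKc : Convex ℝ K := by
    intro q hq q' hq' a b ha hb hab
    have h1 := norm_sq_convex_combination q.1.1 q'.1.1 ha hb hab
    have h2 := norm_sq_convex_combination q.1.2 q'.1.2 ha hb hab
    have h3 : a * (q.2 + (‖q.1.1‖ ^ 2 + ‖q.1.2‖ ^ 2) / 2) +
        b * (q'.2 + (‖q'.1.1‖ ^ 2 + ‖q'.1.2‖ ^ 2) / 2) < 0 := by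
      simp only [hK, Set.mem_ofPred_eq] at hq hq'
      rcases ha.eq_or_lt with rfl | ha'
      · obtain rfl : b = 1 := by linarith
        linarith
      · nlinarith
    change a * q.2 + b * q'.2 + (‖a • q.1.1 + b • q'.1.1‖ ^ 2 + ‖a • q.1.2 + b • q'.1.2‖ ^ 2) / 2 < 0
    linarith
  have hSc : Convex ℝ S := by
    intro q hq q' hq' a b ha hb hab p hp
    have h1 := mul_le_mul_of_nonneg_left (hq p hp) ha
    have h2 := mul_le_mul_of_nonneg_left (hq' p hp) hb
    change p.2 (a • q.1.1 + b • q'.1.1) + (a • q.1.2 + b • q'.1.2) p.1 - p.2 p.1 ≤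
      a * q.2 + b * q'.2
    rw [map_add, map_smul, map_smul, add_apply, smul_apply, smul_apply]
    simp only [smul_eq_mul]
    obtain rfl : b = 1 - a := by linarith
    linarith
  -- A violating point would be strictly monotonically related to all of `G`, hence in `G` by
  -- maximality, hence strictly related to itself.
  have hSle : ∀ q ∈ S, q.1.2 q.1.1 ≤ q.2 := by
    intro q hq
    by_contra! hlt
    have h1 : ∀ p ∈ G, 0 < (q.1.2 - p.2) (q.1.1 - p.1) := by
      intro p hp
      have := hq p hp
      rw [sub_apply, map_sub, map_sub]
      linarith
    have h2 := h1 _ (hmax q.1 fun p hp => (h1 p hp).le)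
    simp at h2
  have hGS : ∀ p ∈ G, (p, p.2 p.1) ∈ S := by
    intro p hp q hq
    have := hmono p hp q hq
    rw [sub_apply, map_sub, map_sub] at this
    simp only
    linarith
  have hdisj : Disjoint K S := by
    rw [Set.disjoint_left]
    intro q hqK hqS
    have h1 := hSle q hqS
    have h2 := (neg_abs_le _).trans' (neg_le_neg (q.1.2.le_opNorm q.1.1))
    simp only [hK, Set.mem_ofPred_eq] at hqK
    nlinarith [sq_nonneg (‖q.1.1‖ - ‖q.1.2‖)]
  obtain ⟨ℓ, u, hℓK, hℓS⟩ := geometric_hahn_banach_open hKc hKo hSc hdisj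
  set g₀ : StrongDual ℝ E := (ℓ.comp (.inl ℝ _ ℝ)).comp (.inl ℝ E _) with hg₀
  obtain ⟨y₀, hy₀⟩ := hrefl ((ℓ.comp (.inl ℝ _ ℝ)).comp (.inr ℝ E _))
  set s : ℝ := ℓ (0, 1) with hs
  have hℓ : ∀ x f t, ℓ ((x, f), t) = g₀ x + f y₀ + t * s := by
    intro x f t
    have e : ((x, f), t) = ((x, 0), 0) + ((0, f), 0) + t • (((0, 0), 1) : (E × StrongDual ℝ E) × ℝ) := by
      simp
    rw [← hy₀ f, e, map_add, map_add, map_smul]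
    rfl
  obtain ⟨⟨x₁, f₁⟩, hp₁⟩ := hne
  -- The hyperplane is not vertical: `K` and `S` both contain points over `(x₁, f₁)`.
  have hs0 : 0 < s := by
    have h1 := hℓS _ (hGS _ hp₁)
    have h2 := hℓK ((x₁, f₁), -(‖x₁‖ ^ 2 + ‖f₁‖ ^ 2) / 2 - 1) (by
      simp only [hK, Set.mem_ofPred_eq]; linarith)
    rw [hℓ] at h1 h2
    have h3 := (neg_abs_le _).trans' (neg_le_neg (f₁.le_opNorm x₁))
    simp only at h1
    have h4 : 0 < (f₁ x₁ - (-(‖x₁‖ ^ 2 + ‖f₁‖ ^ 2) / 2 - 1)) * s := by linarith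
    refine (pos_iff_pos_of_mul_pos h4).mp ?_
    nlinarith [sq_nonneg (‖x₁‖ - ‖f₁‖)]
  set g := s⁻¹ • g₀ with hg
  set y := s⁻¹ • y₀ with hy
  have hup : ∀ (x : E) (f : StrongDual ℝ E), g x + f y ≤ s⁻¹ * u + (‖x‖ ^ 2 + ‖f‖ ^ 2) / 2 := by
    intro x f
    refine le_of_forall_pos_lt_add fun ε hε => ?_
    have h2 := hℓK ((x, f), -(‖x‖ ^ 2 + ‖f‖ ^ 2) / 2 - ε) (by
      simp only [hK, Set.mem_ofPred_eq]; linarith)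
    rw [hℓ] at h2
    have h3 := mul_lt_mul_of_pos_left h2 (inv_pos.mpr hs0)
    rw [hg, hy, smul_apply, map_smul, smul_eq_mul, smul_eq_mul]
    field_simp at h3 ⊢
    linarith
  have hlow : ∀ p ∈ G, s⁻¹ * u ≤ g p.1 + p.2 y + p.2 p.1 := by
    intro p hp
    have h2 := hℓS _ (hGS p hp)
    rw [← Prod.mk.eta (p := p), hℓ] at h2
    have h3 := mul_le_mul_of_nonneg_left h2 (inv_pos.mpr hs0).le
    rw [hg, hy, smul_apply, map_smul, smul_eq_mul, smul_eq_mul]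
    field_simp at h3 ⊢
    linarith
  -- Equality in Fenchel–Young for the quadratic is reached at a preimage of `g` and a dual element
  -- of `y`.
  have hu : (‖g‖ ^ 2 + ‖y‖ ^ 2) / 2 ≤ s⁻¹ * u := by
    obtain ⟨x, hx⟩ := hsurj g
    obtain ⟨f, hf⟩ := dualitySet_nonempty y
    have := hup x f
    rw [hx.1, apply_self_of_mem_dualitySet hf, norm_of_mem_dualitySet hf, ← hx.2] at this
    linarith
  have hgy := abs_le.mp (g.le_opNorm y)
  have hmem : (-y, -g) ∈ G := by
    refine hmax _ fun q hq => ?_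
    have h1 := hlow q hq
    simp only [sub_apply, map_sub, map_neg, neg_apply]
    nlinarith [sq_nonneg (‖g‖ - ‖y‖)]
  refine ⟨_, hmem, ?_⟩
  -- Testing the lower bound at `(-y, -g)` itself gives `(‖g‖² + ‖y‖²) / 2 ≤ -g y`, which forces
  -- `‖g‖ = ‖y‖` and `g y = -‖y‖²`.
  have h1 := hlow _ hmem
  simp only [map_neg, neg_apply, neg_neg] at h1 ⊢
  have h2 : (‖g‖ - ‖y‖) ^ 2 ≤ 0 := by nlinarith
  have h3 : ‖g‖ = ‖y‖ := by nlinarith [pow_eq_zero_iff (two_ne_zero) |>.mp (le_antisymm h2 (sq_nonneg _))]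
  rw [h3] at hgy hu
  refine ⟨?_, by rw [norm_neg, h3]⟩
  rw [map_neg, h3]
  nlinarith

theorem IsMaximalMonotone.mem {B : E → Set (StrongDual ℝ E)} (hB : IsMaximalMonotone B) {x : E}
    {f : StrongDual ℝ E} (h : ∀ y, ∀ g ∈ B y, 0 ≤ (f - g) (x - y)) : f ∈ B x := by
  have hS := hB.2 (fun y => B y ∪ {g | y = x ∧ g = f}) ?_ fun y => Set.subset_union_left
  · rw [hS]
    exact Or.inr ⟨rfl, rfl⟩
  · rintro y z g (hg | ⟨rfl, rfl⟩) k (hk | ⟨rfl, rfl⟩)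
    · exact hB.1 y z g hg k hk
    · have := h y g hg
      rwa [← neg_sub g, ← neg_sub y, map_neg, neg_apply, neg_neg] at this
    · exact h z k hk
    · simp

theorem IsMaximalMonotone.exists_sub_smul_mem_dualitySet
    (hrefl : ∀ F : StrongDual ℝ (StrongDual ℝ E), ∃ x : E, ∀ f, F f = f x)
    (hsurj : ∀ f : StrongDual ℝ E, ∃ x, f ∈ dualitySet x)
    {B : E → Set (StrongDual ℝ E)} (hB : IsMaximalMonotone B) (hne : ∃ x, (B x).Nonempty)
    {r : ℝ} (hr : 0 < r) (x₀ : E) (p : StrongDual ℝ E) :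
    ∃ z, ∃ v ∈ B z, p - r • v ∈ dualitySet (z - x₀) := by
  have key : ∃ q ∈ {q : E × StrongDual ℝ E | ∃ v ∈ B (q.1 + x₀), q.2 = r • v - p},
      -q.2 ∈ dualitySet q.1 := by
    obtain ⟨x, v, hv⟩ := hne
    -- Translation, scaling and subtraction of `p` preserve maximal monotonicity.
    refine exists_neg_mem_dualitySet hrefl hsurj
      ⟨(x - x₀, r • v - p), v, by simpa using hv, rfl⟩ ?_ ?_
    · rintro ⟨x', f⟩ ⟨v, hv, rfl⟩ ⟨y, g⟩ ⟨w, hw, rfl⟩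
      have := hB.1 _ _ v hv w hw
      simp only
      rw [show r • v - p - (r • w - p) = r • (v - w) by module, smul_apply, smul_eq_mul]
      rw [add_sub_add_right_eq_sub] at this
      positivity
    · rintro ⟨x, f⟩ h
      refine ⟨r⁻¹ • (f + p), hB.mem fun y g hg => ?_, ?_⟩
      · have := h (y - x₀, r • g - p) ⟨g, by simpa using hg, rfl⟩
        simp only at this ⊢
        rw [show r⁻¹ • (f + p) - g = r⁻¹ • (f - (r • g - p)) by
            rw [smul_sub, smul_sub, smul_add, smul_smul, inv_mul_cancel₀ hr.ne']; module,
          show x + x₀ - y = x - (y - x₀) by abel, smul_apply, smul_eq_mul]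
        positivity
      · rw [smul_smul, mul_inv_cancel₀ hr.ne']
        simp
  obtain ⟨⟨z, f⟩, ⟨v, hv, rfl⟩, h⟩ := key
  exact ⟨z + x₀, v, hv, by simpa using h⟩

/-- Minty's characterization of the zeros of `A + B`. -/
theorem mem_solutionSet_iff
    (hrefl : ∀ F : StrongDual ℝ (StrongDual ℝ E), ∃ x : E, ∀ f, F f = f x)
    (hsurj : ∀ f : StrongDual ℝ E, ∃ x, f ∈ dualitySet x)
    {A : E → StrongDual ℝ E} {B : E → Set (StrongDual ℝ E)} {L : ℝ} (hL : 0 < L)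
    (hA_mono : ∀ x y : E, 0 ≤ (A x - A y) (x - y))
    (hA_lip : ∀ x y : E, ‖A x - A y‖ ≤ L * ‖x - y‖)
    (hB : IsMaximalMonotone B) (hne : ∃ x, (B x).Nonempty) {z : E} :
    z ∈ solutionSet A B ↔ ∀ y, ∀ v ∈ B y, 0 ≤ (A y + v) (y - z) := by
  constructor
  · rintro ⟨v₀, hv₀, h⟩ y v hv
    have h1 := hA_mono y z
    have h2 := hB.1 y z v hv v₀ hv₀
    have h3 : A y + v = (A y - A z) + (v - v₀) := by
      rw [eq_neg_of_add_eq_zero_left h]; abel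
    rw [h3, add_apply]
    positivity
  · intro h
    -- Here `-(A z + v) / (2L) ∈ dualitySet (y - z)`. Testing at `(y, v)` gives `2L‖y - z‖² ≤ ⟨A y -
    -- A z, y - z⟩ ≤ L‖y - z‖²`, so `y = z`; maximality of `A + B` is never needed.
    obtain ⟨y, v, hv, hyv⟩ := hB.exists_sub_smul_mem_dualitySet hrefl hsurj hne
      (r := (2 * L)⁻¹) (by positivity) z (-((2 * L)⁻¹ • A z))
    have h1 := h y v hv
    have h2 := apply_self_of_mem_dualitySet hyv
    have h3 := (le_abs_self _).trans ((A y - A z).le_opNorm (y - z))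
    have h4 := mul_le_mul_of_nonneg_right (hA_lip y z) (norm_nonneg (y - z))
    simp only [sub_apply, add_apply, neg_apply, smul_apply, smul_eq_mul] at h1 h2 h3
    have h5 : ‖y - z‖ ^ 2 ≤ 0 := by
      have h6 : 2 * L * ‖y - z‖ ^ 2 ≤ L * ‖y - z‖ ^ 2 := by
        rw [← h2]
        field_simp
        have h7 : ‖y - z‖ ^ 2 * (2 * L) = -(A z) (y - z) - v (y - z) := by
          rw [← h2]; field_simp
        nlinarith
      nlinarith
    have h6 : ‖y - z‖ = 0 := by
      exact pow_eq_zero_iff two_ne_zero |>.mp (le_antisymm h5 (sq_nonneg _))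
    have h7 := norm_of_mem_dualitySet hyv
    rw [h6, norm_eq_zero] at h7
    obtain rfl : y = z := sub_eq_zero.mp (norm_eq_zero.mp h6)
    refine ⟨v, hv, ?_⟩
    have h8 : (2 * L)⁻¹ • (A y + v) = 0 := by
      rw [smul_add, ← neg_eq_zero, ← h7]; abel
    exact (smul_eq_zero.mp h8).resolve_left (by positivity)

end MonotoneOperators

/-! ### Recursive inequalities, the Lyapunov functional, projections. -/

section Convergence

variable {E : Type*} [NormedAddCommGroup E] [NormedSpace ℝ E]

/-- Xu's lemma on sequences with `s (n + 1) ≤ (1 - α n) s n + α n β n`. -/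
theorem tendsto_zero_of_le_convex_combination {s α β : ℕ → ℝ} (hs : ∀ n, 0 ≤ s n)
    (hα : ∀ n : ℕ, 1 ≤ n → 0 < α n ∧ α n < 1)
    (hα_sum : Tendsto (fun N : ℕ => ∑ n ∈ Finset.Icc 1 N, α n) atTop atTop)
    (hβ : ∀ ε > 0, ∀ᶠ n in atTop, β n ≤ ε)
    (h : ∀ n, 1 ≤ n → s (n + 1) ≤ (1 - α n) * s n + α n * β n) :
    Tendsto s atTop (𝓝 0) := by
  set T : ℕ → ℝ := fun N => ∑ n ∈ Finset.Icc 1 N, α n with hT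
  rw [Metric.tendsto_nhds]
  intro ε hε
  obtain ⟨M, hM⟩ := eventually_atTop.mp (hβ (ε / 2) (half_pos hε))
  -- Past `M` the excess over `ε / 2` contracts by `1 - α ≤ exp (-α)`; the product telescopes in the
  -- partial sums `T`.
  have key : ∀ k, s (M + k + 1) - ε / 2 ≤ s (M + 1) * Real.exp (T M - T (M + k)) := by
    intro k
    induction k with
    | zero => simp; linarith
    | succ k ih =>
      have h1 := h (M + k + 1) (by omega)
      have h2 := hM (M + k + 1) (by omega)
      obtain ⟨h3, h4⟩ := hα (M + k + 1) (by omega)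
      have h5 : T (M + (k + 1)) = T (M + k) + α (M + k + 1) :=
        Finset.sum_Icc_succ_top (by omega) _
      have h6 : T M - T (M + (k + 1)) = -α (M + k + 1) + (T M - T (M + k)) := by rw [h5]; ring
      rw [h6, Real.exp_add]
      calc s (M + (k + 1) + 1) - ε / 2
          ≤ (1 - α (M + k + 1)) * (s (M + k + 1) - ε / 2) := by
            have := mul_le_mul_of_nonneg_left h2 h3.le
            rw [show M + (k + 1) + 1 = M + k + 1 + 1 by ring]
            linarith
        _ ≤ (1 - α (M + k + 1)) * (s (M + 1) * Real.exp (T M - T (M + k))) :=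
            mul_le_mul_of_nonneg_left ih (by linarith)
        _ ≤ Real.exp (-α (M + k + 1)) * (s (M + 1) * Real.exp (T M - T (M + k))) :=
            mul_le_mul_of_nonneg_right (Real.one_sub_le_exp_neg _)
              (mul_nonneg (hs _) (Real.exp_pos _).le)
        _ = _ := by ring
  have h1 : Tendsto (fun n => s (M + 1) * Real.exp (T M - T n)) atTop (𝓝 (s (M + 1) * 0)) := by
    refine (Real.tendsto_exp_atBot.comp ?_).const_mul _
    exact tendsto_atBot_add_const_left _ _ (tendsto_neg_atTop_atBot.comp hα_sum)
  rw [mul_zero] at h1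
  obtain ⟨N, hN⟩ := eventually_atTop.mp (h1.eventually (gt_mem_nhds (half_pos hε)))
  filter_upwards [eventually_ge_atTop (M + N + 1)] with n hn
  obtain ⟨k, rfl⟩ : ∃ k, n = M + k + 1 := ⟨n - M - 1, by omega⟩
  rw [Real.dist_eq, sub_zero, abs_of_nonneg (hs _)]
  linarith [key k, hN (M + k) (by omega)]

theorem dualityMap_self (x : E) : dualityMap x x = ‖x‖ ^ 2 :=
  apply_self_of_mem_dualitySet (dualityMap_mem x)

theorem norm_dualityMap (x : E) : ‖dualityMap x‖ = ‖x‖ :=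
  norm_of_mem_dualitySet (dualityMap_mem x)

theorem StronglyConvexSq.le_lyapunov {c : ℝ} (hc : StronglyConvexSq E c) (x y : E) :
    c * ‖x - y‖ ^ 2 ≤ lyapunov x y := by
  have h := hc.subgradient (dualityMap_mem y) (x - y)
  rw [add_sub_cancel, map_sub, dualityMap_self] at h
  unfold lyapunov
  linarith

theorem lyapunov_nonneg (x y : E) : 0 ≤ lyapunov x y := by
  have h := subgradient_of_mem_dualitySet (dualityMap_mem y) (x - y)
  rw [add_sub_cancel, map_sub, dualityMap_self] at h
  unfold lyapunov
  linarith

theorem lyapunov_le_of_dualityMap_eq_convex {x₁ w u : E} {t : ℝ} (ht0 : 0 ≤ t) (ht1 : t ≤ 1)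
    (hu : dualityMap u = t • dualityMap x₁ + (1 - t) • dualityMap w) (p : E) :
    lyapunov p u ≤ t * lyapunov p x₁ + (1 - t) * lyapunov p w := by
  have h := norm_sq_convex_combination (dualityMap x₁) (dualityMap w) ht0 (sub_nonneg.mpr ht1)
    (by ring)
  rw [← hu, norm_dualityMap, norm_dualityMap, norm_dualityMap] at h
  unfold lyapunov
  rw [hu, add_apply, smul_apply, smul_apply, smul_eq_mul, smul_eq_mul]
  linarith

/-- Write `J u = k + t (J x₁ - J z)` with `k = t J z + (1 - t) J w`. Convexity of the squared norm
at `k` gives the contraction, and Young's inequality for `k u` gives the linear term at `u`. -/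
theorem lyapunov_le_halpern {x₁ w u : E} {t : ℝ} (ht0 : 0 ≤ t) (ht1 : t ≤ 1)
    (hu : dualityMap u = t • dualityMap x₁ + (1 - t) • dualityMap w) (z : E) :
    lyapunov z u ≤ (1 - t) * lyapunov z w +
      t * (2 * (dualityMap x₁ - dualityMap z) (u - z)) := by
  have h1 := norm_sq_convex_combination (dualityMap z) (dualityMap w) ht0 (sub_nonneg.mpr ht1)
    (by ring)
  set k := t • dualityMap z + (1 - t) • dualityMap w with hk
  have h2 := (le_abs_self _).trans (k.le_opNorm u)
  have h3 : dualityMap u u = t * dualityMap x₁ u + (1 - t) * dualityMap w u := by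
    rw [hu, add_apply, smul_apply, smul_apply, smul_eq_mul, smul_eq_mul]
  have h4 : k u = t * dualityMap z u + (1 - t) * dualityMap w u := by
    rw [hk, add_apply, smul_apply, smul_apply, smul_eq_mul, smul_eq_mul]
  rw [dualityMap_self] at h3
  rw [norm_dualityMap, norm_dualityMap] at h1
  unfold lyapunov
  rw [hu, add_apply, smul_apply, smul_apply, smul_eq_mul, smul_eq_mul, sub_apply, map_sub, map_sub,
    dualityMap_self z]
  nlinarith [sq_nonneg (‖k‖ - ‖u‖)]

/-- The basic inequality for one forward-backward-forward step. -/
theorem lyapunov_le_forwardBackwardForward [CompleteSpace E] {c : ℝ} (hc0 : 0 < c)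
    (hc : StronglyConvexSq E c) {Ax Ay v : StrongDual ℝ E} {x y w p : E} {r : ℝ} (hr : 0 ≤ r)
    (hy : dualityMap x - r • Ax = dualityMap y + r • v)
    (hw : dualityMap w = dualityMap y - r • (Ay - Ax)) (hp : 0 ≤ (Ay + v) (y - p)) :
    lyapunov p w ≤ lyapunov p x - lyapunov y x +
      2 * uniformSmoothnessConst (StrongDual ℝ E) ^ 2 * (r * ‖Ay - Ax‖) ^ 2 := by
  -- `J w` is a perturbation of `J y`, at which the gradient of the dual norm squared is `2y`.
  have h1 := norm_add_sq_le_uniformSmoothnessConst hc0 hc (dualityMap_mem y) (-(r • (Ay - Ax)))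
  rw [← sub_eq_add_neg, ← hw, norm_dualityMap, norm_dualityMap, norm_neg, norm_smul,
    Real.norm_of_nonneg hr] at h1
  have hx : dualityMap x = dualityMap y + r • v + r • Ax := by rw [← hy]; abel
  have h2 := mul_nonneg hr hp
  have h3 := dualityMap_self y
  unfold lyapunov
  rw [hw, hx]
  simp only [add_apply, sub_apply, neg_apply, smul_apply, smul_eq_mul, map_sub] at h1 h2 ⊢
  linarith

/-- The generalized projection onto a closed convex set, with its variational inequality. -/
theorem exists_generalizedProjection [CompleteSpace E] {c : ℝ} (hc0 : 0 < c)
    (hc : StronglyConvexSq E c) (hE : UniformlySmooth E) {C : Set E} (hne : C.Nonempty)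
    (hcl : IsClosed C) (hcv : Convex ℝ C) (x : E) :
    ∃ z ∈ C, (∀ z', IsGeneralizedProjection C x z' ↔ z' = z) ∧
      ∀ u ∈ C, (dualityMap x - dualityMap z) (u - z) ≤ 0 := by
  obtain ⟨z, hz, hmin⟩ := exists_minimizer hc0 hc hne hcl hcv (dualityMap x)
  refine ⟨z, hz, fun z' => ⟨fun h => ?_, ?_⟩, fun u hu => ?_⟩
  · have h1 := h.2 z hz
    have h2 := hmin z' h.1
    unfold lyapunov at h1
    have h3 : c / 2 * ‖z - z'‖ ^ 2 ≤ 0 := by linarith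
    have h4 : ‖z - z'‖ ^ 2 ≤ 0 := by
      by_contra! h5
      nlinarith
    have h5 := pow_eq_zero_iff two_ne_zero |>.mp (le_antisymm h4 (sq_nonneg _))
    exact (sub_eq_zero.mp (norm_eq_zero.mp h5)).symm
  · rintro rfl
    refine ⟨hz, fun y hy => ?_⟩
    have h1 := hmin y hy
    have h2 : 0 ≤ c / 2 * ‖z' - y‖ ^ 2 := by positivity
    unfold lyapunov
    linarith
  · set d := u - z with hd
    -- Minimality along the segment gives `⟨J x - J (z + t d), d⟩ ≤ 0`; continuity of `J` lets `t →
    -- 0⁺`.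
    have h1 : Tendsto (fun t : ℝ => ‖(z + t • d) - z‖) (𝓝[>] 0) (𝓝 0) := by
      have : Continuous fun t : ℝ => ‖(z + t • d) - z‖ := by fun_prop
      simpa using (this.tendsto 0).mono_left (nhdsWithin_le_nhds (s := Set.Ioi 0))
    have h2 := hE.tendsto_norm_dualityMap_sub (x := fun _ => z) (R := ‖z‖)
      (Eventually.of_forall fun _ => le_rfl) h1
    have h3 := h2.mul_const ‖d‖
    rw [zero_mul] at h3
    refine ge_of_tendsto h3 ?_
    filter_upwards [Ioo_mem_nhdsGT (zero_lt_one (α := ℝ))] with t ht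
    have h4 : z + t • d ∈ C := hcv.add_smul_sub_mem hz hu ⟨ht.1.le, ht.2.le⟩
    have h5 := hmin _ h4
    have h6 : 0 ≤ c / 2 * ‖z - (z + t • d)‖ ^ 2 := by positivity
    have h7 := subgradient_of_mem_dualitySet (dualityMap_mem (z + t • d)) (-(t • d))
    rw [add_neg_cancel_right, map_neg, map_smul, smul_eq_mul] at h7
    rw [map_add, map_smul, smul_eq_mul] at h5
    have h8 := (le_abs_self _).trans ((dualityMap (z + t • d) - dualityMap z).le_opNorm d)
    refine le_trans ?_ h8
    rw [sub_apply, sub_apply]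
    have h9 : t * dualityMap x d ≤ t * dualityMap (z + t • d) d := by linarith
    linarith [le_of_mul_le_mul_left h9 ht.1]

/-- Monotonicity moves the operators to the fixed pair `(u, g)`, where weak convergence of `y`
suffices; the residual vanishes against bounded vectors. -/
theorem nonneg_of_weak_limit {A : E → StrongDual ℝ E} {B : E → Set (StrongDual ℝ E)}
    (hA_mono : ∀ x y : E, 0 ≤ (A x - A y) (x - y)) (hB : IsMonotoneOperator B)
    {ι : Type*} {l : Filter ι} [l.NeBot] {y : ι → E} {v : ι → StrongDual ℝ E} {R : ℝ} {p : E}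
    (hR : ∀ᶠ i in l, ‖y i‖ ≤ R) (hv : ∀ᶠ i in l, v i ∈ B (y i))
    (hlim : Tendsto (fun i => ‖A (y i) + v i‖) l (𝓝 0))
    (hp : ∀ f : StrongDual ℝ E, Tendsto (fun i => f (y i)) l (𝓝 (f p)))
    (u : E) (g : StrongDual ℝ E) (hg : g ∈ B u) : 0 ≤ (A u + g) (u - p) := by
  have h1 : Tendsto (fun i => -(‖A (y i) + v i‖ * (‖u‖ + R))) l (𝓝 (-(0 * (‖u‖ + R)))) :=
    (hlim.mul_const _).neg
  rw [zero_mul, neg_zero] at h1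
  have h2 : Tendsto (fun i => (A u + g) u - (A u + g) (y i)) l
      (𝓝 ((A u + g) u - (A u + g) p)) := tendsto_const_nhds.sub (hp _)
  rw [map_sub]
  refine le_of_tendsto_of_tendsto h1 h2 ?_
  filter_upwards [hR, hv] with i hi hvi
  have h3 := hA_mono u (y i)
  have h4 := hB u (y i) g hg _ hvi
  have h5 := neg_le_of_abs_le ((A (y i) + v i).le_opNorm (u - y i))
  have h6 : ‖A (y i) + v i‖ * ‖u - y i‖ ≤ ‖A (y i) + v i‖ * (‖u‖ + R) := by
    gcongr
    exact (norm_sub_le _ _).trans (by linarith)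
  simp only [add_apply, sub_apply, map_sub] at h3 h4 h5 ⊢
  linarith

theorem resolvent_spec
    (hrefl : ∀ F : StrongDual ℝ (StrongDual ℝ E), ∃ x : E, ∀ f, F f = f x)
    (hsurj : ∀ f : StrongDual ℝ E, ∃ x, f ∈ dualitySet x) (hE : UniformlySmooth E)
    {B : E → Set (StrongDual ℝ E)} (hB : IsMaximalMonotone B) (hne : ∃ x, (B x).Nonempty)
    {r : ℝ} (hr : 0 < r) (x : E) :
    ∃ v ∈ B (resolvent B r x), dualityMap x = dualityMap (resolvent B r x) + r • v := by
  refine Classical.epsilon_spec (p := fun z : E => ∃ v ∈ B z, dualityMap x = dualityMap z + r • v) ?_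
  obtain ⟨z, v, hv, h⟩ := hB.exists_sub_smul_mem_dualitySet hrefl hsurj hne hr 0 (dualityMap x)
  rw [sub_zero] at h
  refine ⟨z, v, hv, ?_⟩
  rw [hE.eq_of_mem_dualitySet (dualityMap_mem z) h]
  abel

/-- Minty's form exhibits the set as an intersection of closed half-spaces. -/
theorem isClosed_solutionSet_and_convex {A : E → StrongDual ℝ E} {B : E → Set (StrongDual ℝ E)}
    (h : ∀ z, z ∈ solutionSet A B ↔ ∀ y, ∀ v ∈ B y, 0 ≤ (A y + v) (y - z)) :
    IsClosed (solutionSet A B) ∧ Convex ℝ (solutionSet A B) := by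
  constructor
  · have e : solutionSet A B = ⋂ (y) (v) (_ : v ∈ B y), {z | 0 ≤ (A y + v) (y - z)} := by
      ext z
      simp [h]
    rw [e]
    refine isClosed_iInter fun y => isClosed_iInter fun v => isClosed_iInter fun _ => ?_
    exact isClosed_le continuous_const (by fun_prop)
  · intro z hz z' hz' s t hs ht hst
    rw [h] at hz hz' ⊢
    intro y v hv
    have e : y - (s • z + t • z') = s • (y - z) + t • (y - z') := by
      obtain rfl : t = 1 - s := by linarith
      module
    rw [e, map_add, map_smul, map_smul, smul_eq_mul, smul_eq_mul]
    exact add_nonneg (mul_nonneg hs (hz y v hv)) (mul_nonneg ht (hz' y v hv))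

end Convergence

/-! ### Convergence of the Halpern iteration. -/

section Iteration

variable {E : Type*} [NormedAddCommGroup E] [NormedSpace ℝ E]

theorem StronglyConvexSq.tendsto_norm_sub {c : ℝ} (hc0 : 0 < c) (hc : StronglyConvexSq E c)
    {ι : Type*} {l : Filter ι} {x y : ι → E}
    (h : Tendsto (fun i => lyapunov (x i) (y i)) l (𝓝 0)) :
    Tendsto (fun i => ‖x i - y i‖) l (𝓝 0) := by
  have h1 := (Real.continuous_sqrt.tendsto _).comp (h.const_mul c⁻¹)
  rw [mul_zero, Real.sqrt_zero] at h1
  refine squeeze_zero (fun _ => norm_nonneg _) (fun i => Real.le_sqrt_of_sq_le ?_) h1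
  rw [le_inv_mul_iff₀ hc0]
  exact hc.le_lyapunov _ _

/-- Strong convergence of the Halpern iteration of a forward-backward-forward step that decreases
the Lyapunov functional. -/
theorem tendsto_halpern_forwardBackwardForward [CompleteSpace E] {c : ℝ} (hc0 : 0 < c)
    (hc : StronglyConvexSq E c) (hE : UniformlySmooth E)
    {A : E → StrongDual ℝ E} {B : E → Set (StrongDual ℝ E)} {L : ℝ}
    (hA_mono : ∀ x y : E, 0 ≤ (A x - A y) (x - y))
    (hA_lip : ∀ x y : E, ‖A x - A y‖ ≤ L * ‖x - y‖)
    (hB : IsMonotoneOperator B) {z : E}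
    {lam α : ℕ → ℝ} {a b θ : ℝ} (ha : 0 < a) (hθ : 0 < θ)
    (hlam : ∀ n : ℕ, 1 ≤ n → a ≤ lam n ∧ lam n ≤ b)
    (hα : ∀ n : ℕ, 1 ≤ n → 0 < α n ∧ α n < 1) (hα_lim : Tendsto α atTop (𝓝 0))
    (hα_sum : Tendsto (fun N : ℕ => ∑ n ∈ Finset.Icc 1 N, α n) atTop atTop)
    {x y w : ℕ → E} {v : ℕ → StrongDual ℝ E} (hv : ∀ n, 1 ≤ n → v n ∈ B (y n))
    (hy : ∀ n, 1 ≤ n → dualityMap (x n) - lam n • A (x n) = dualityMap (y n) + lam n • v n)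
    (hw : ∀ n, 1 ≤ n → dualityMap (w n) = dualityMap (y n) - lam n • (A (y n) - A (x n)))
    (hx : ∀ n, 1 ≤ n →
      dualityMap (x (n + 1)) = α n • dualityMap (x 1) + (1 - α n) • dualityMap (w n))
    (hstep : ∀ n, 1 ≤ n → lyapunov z (w n) ≤ lyapunov z (x n) - θ * lyapunov (y n) (x n))
    (hvar : ∀ p, (∀ u, ∀ g ∈ B u, 0 ≤ (A u + g) (u - p)) →
      (dualityMap (x 1) - dualityMap z) (p - z) ≤ 0) :
    Tendsto x atTop (𝓝 z) := by
  set M := lyapunov z (x 1) with hM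
  have hM0 : 0 ≤ M := lyapunov_nonneg _ _
  have hbd : ∀ n, 1 ≤ n → lyapunov z (x n) ≤ M := by
    intro n hn
    induction n, hn using Nat.le_induction with
    | base => exact le_rfl
    | succ n hn ih =>
      obtain ⟨h1, h2⟩ := hα n hn
      have h3 := lyapunov_le_of_dualityMap_eq_convex h1.le h2.le (hx n hn) z
      have h4 := hstep n hn
      have h5 := mul_nonneg hθ.le (lyapunov_nonneg (y n) (x n))
      have h6 : lyapunov z (w n) ≤ M := by linarith
      have h7 := mul_le_mul_of_nonneg_left h6 (sub_nonneg.mpr h2.le)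
      linarith
  have hφ : ∀ n, 1 ≤ n → lyapunov (y n) (x n) ≤ M / θ := by
    intro n hn
    rw [le_div_iff₀ hθ]
    linarith [hstep n hn, hbd n hn, lyapunov_nonneg z (w n)]
  have hnorm : ∀ (p q : E) (K : ℝ), 0 ≤ K → lyapunov p q ≤ K → ‖p - q‖ ≤ 1 + K / c := by
    intro p q K hK h
    have h1 : ‖p - q‖ ^ 2 ≤ K / c := by
      rw [le_div_iff₀ hc0]
      linarith [hc.le_lyapunov p q]
    nlinarith [sq_nonneg (‖p - q‖ - 1)]
  set R₁ := ‖z‖ + (1 + M / c) with hR₁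
  set R₂ := R₁ + (1 + M / θ / c) with hR₂
  have hxR : ∀ n, 1 ≤ n → ‖x n‖ ≤ R₁ := by
    intro n hn
    have h1 := hnorm _ _ M hM0 (hbd n hn)
    have h2 := norm_sub_norm_le (x n) z
    rw [norm_sub_rev] at h2
    linarith
  have hyR : ∀ n, 1 ≤ n → ‖y n‖ ≤ R₂ := by
    intro n hn
    have h1 := hnorm _ _ (M / θ) (by positivity) (hφ n hn)
    have h2 := norm_sub_norm_le (y n) (x n)
    linarith [hxR n hn]
  set h := dualityMap (x 1) - dualityMap z with hh
  -- The decrease is kept inside `β`, so that a lower bound on `β` controls `φ(y n, x n)`.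
  set β : ℕ → ℝ := fun n =>
    2 * h (x (n + 1) - z) - (1 - α n) * θ * lyapunov (y n) (x n) / α n with hβ
  have hrec : ∀ n, 1 ≤ n → lyapunov z (x (n + 1)) ≤ (1 - α n) * lyapunov z (x n) + α n * β n := by
    intro n hn
    obtain ⟨h1, h2⟩ := hα n hn
    have h3 := lyapunov_le_halpern h1.le h2.le (hx n hn) z
    have h4 := mul_le_mul_of_nonneg_left (hstep n hn) (sub_nonneg.mpr h2.le)
    have h5 : α n * β n = α n * (2 * h (x (n + 1) - z)) -
        (1 - α n) * θ * lyapunov (y n) (x n) := by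
      simp only [hβ]
      field_simp
    rw [h5]
    linarith
  suffices hlim : ∀ ε > 0, ∀ᶠ n in atTop, β n ≤ ε by
    have h1 := tendsto_zero_of_le_convex_combination (fun n => lyapunov_nonneg z (x n)) hα hα_sum
      hlim hrec
    have h2 := hc.tendsto_norm_sub hc0 h1
    simp only [norm_sub_rev z] at h2
    exact tendsto_iff_norm_sub_tendsto_zero.mpr h2
  intro ε hε
  by_contra hcon
  have hfreq : ∃ᶠ n in atTop, ε < β n := by
    simpa [Filter.Frequently, not_lt] using hcon
  -- The ultrafilter plays the role of a subsequence along which weak limits exist.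
  obtain ⟨U, hUt, hUβ⟩ : ∃ U : Ultrafilter ℕ, (U : Filter ℕ) ≤ atTop ∧
      ∀ᶠ n in (U : Filter ℕ), ε < β n := by
    have : (atTop ⊓ 𝓟 {n | ε < β n}).NeBot := frequently_mem_iff_neBot.mp hfreq
    have hle := Ultrafilter.of_le (atTop ⊓ 𝓟 {n | ε < β n})
    exact ⟨_, hle.trans inf_le_left, le_principal_iff.mp (hle.trans inf_le_right)⟩
  have hU1 : ∀ᶠ n in (U : Filter ℕ), 1 ≤ n := hUt (eventually_ge_atTop 1)
  have hUα : Tendsto α U (𝓝 0) := hα_lim.mono_left hUt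
  set K := 2 * (‖h‖ * (R₁ + ‖z‖)) with hK
  -- From `ε < β n` and `0 < ε`, the subtracted term is at most `K`; once `α n < 1/2` this reads
  -- `φ(y n, x n) ≤ α n * (2K/θ)`.
  have hφU : Tendsto (fun n => lyapunov (y n) (x n)) U (𝓝 0) := by
    have h1 : Tendsto (fun n => α n * (2 * K / θ)) U (𝓝 (0 * (2 * K / θ))) := hUα.mul_const _
    rw [zero_mul] at h1
    refine squeeze_zero' (Eventually.of_forall fun n => lyapunov_nonneg _ _) ?_ h1
    filter_upwards [hU1, hUβ, hUα.eventually (gt_mem_nhds (half_pos one_pos))] with n hn hβn hαn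
    obtain ⟨h2, h3⟩ := hα n hn
    have h4 : 2 * h (x (n + 1) - z) ≤ K := by
      have h5 := (le_abs_self _).trans (h.le_opNorm (x (n + 1) - z))
      have h6 : ‖x (n + 1) - z‖ ≤ R₁ + ‖z‖ :=
        (norm_sub_le _ _).trans (by linarith [hxR (n + 1) (by omega)])
      have h7 := mul_le_mul_of_nonneg_left h6 (norm_nonneg h)
      linarith
    have h5 : (1 - α n) * θ * lyapunov (y n) (x n) / α n ≤ K := by
      simp only [hβ] at hβn
      linarith
    rw [div_le_iff₀ h2] at h5
    have h6 := mul_nonneg hθ.le (lyapunov_nonneg (y n) (x n))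
    rw [← mul_div_assoc, le_div_iff₀ hθ]
    nlinarith
  have hyx : Tendsto (fun n => ‖y n - x n‖) U (𝓝 0) := hc.tendsto_norm_sub hc0 hφU
  have hJ : Tendsto (fun n => ‖dualityMap (y n) - dualityMap (x n)‖) U (𝓝 0) :=
    hE.tendsto_norm_dualityMap_sub (R := R₁) (hU1.mono hxR) hyx
  have hA : Tendsto (fun n => ‖A (y n) - A (x n)‖) U (𝓝 0) := by
    have h1 := hyx.const_mul L
    rw [mul_zero] at h1
    exact squeeze_zero (fun _ => norm_nonneg _) (fun n => hA_lip _ _) h1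
  have hAv : Tendsto (fun n => ‖A (y n) + v n‖) U (𝓝 0) := by
    have h1 := (hJ.const_mul a⁻¹).add hA
    rw [mul_zero, add_zero] at h1
    refine squeeze_zero' (Eventually.of_forall fun _ => norm_nonneg _) ?_ h1
    filter_upwards [hU1] with n hn
    have hl : 0 < lam n := ha.trans_le (hlam n hn).1
    have e : A (y n) + v n =
        (lam n)⁻¹ • (dualityMap (x n) - dualityMap (y n)) + (A (y n) - A (x n)) := by
      have h2 : dualityMap (x n) - dualityMap (y n) = lam n • (v n + A (x n)) := by
        rw [eq_add_of_sub_eq (hy n hn), smul_add]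
        abel
      rw [h2, smul_smul, inv_mul_cancel₀ hl.ne', one_smul]
      abel
    rw [e]
    refine (norm_add_le _ _).trans ?_
    rw [norm_smul, norm_inv, Real.norm_of_nonneg hl.le, norm_sub_rev (dualityMap (x n))]
    gcongr
    exact (hlam n hn).1
  have hxy : Tendsto (fun n => ‖x (n + 1) - y n‖) U (𝓝 0) := by
    have h1 := ((hUα.mul_const (‖x 1‖ + R₂)).add (hA.const_mul b)).const_mul c⁻¹
    rw [zero_mul, mul_zero, add_zero, mul_zero] at h1
    refine squeeze_zero' (Eventually.of_forall fun _ => norm_nonneg _) ?_ h1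
    filter_upwards [hU1] with n hn
    obtain ⟨h2, h3⟩ := hα n hn
    have hl := hlam n hn
    have hl0 : 0 < lam n := ha.trans_le hl.1
    rw [le_inv_mul_iff₀ hc0]
    refine (hc.norm_sub_le (dualityMap_mem _) (dualityMap_mem _)).trans ?_
    have e : dualityMap (x (n + 1)) - dualityMap (y n) =
        α n • (dualityMap (x 1) - dualityMap (y n)) -
          ((1 - α n) * lam n) • (A (y n) - A (x n)) := by
      rw [hx n hn, hw n hn]
      module
    rw [e]
    refine (norm_sub_le _ _).trans (add_le_add ?_ ?_)
    · rw [norm_smul, Real.norm_of_nonneg h2.le]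
      gcongr
      refine (norm_sub_le _ _).trans ?_
      rw [norm_dualityMap, norm_dualityMap]
      gcongr
      exact hyR n hn
    · rw [norm_smul, Real.norm_of_nonneg (mul_nonneg (sub_nonneg.mpr h3.le) hl0.le)]
      gcongr
      nlinarith
  obtain ⟨p, hp⟩ := exists_weak_limit (hc.reflexive hc0) U (hU1.mono hyR)
  have hpS := hvar p (nonneg_of_weak_limit hA_mono hB (hU1.mono hyR) (hU1.mono hv) hAv hp)
  have h1 : Tendsto (fun n => h (x (n + 1) - y n)) U (𝓝 0) :=
    h.map_zero ▸ (h.continuous.tendsto 0).comp (tendsto_zero_iff_norm_tendsto_zero.mpr hxy)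
  have h2 : Tendsto (fun n => 2 * (h (x (n + 1) - y n) + h (y n) - h z)) U
      (𝓝 (2 * (0 + h p - h z))) := ((h1.add (hp h)).sub_const _).const_mul 2
  have h3 : ε ≤ 2 * (0 + h p - h z) := by
    refine ge_of_tendsto h2 ?_
    filter_upwards [hU1, hUβ] with n hn hβn
    obtain ⟨h4, h5⟩ := hα n hn
    have h6 : 0 ≤ (1 - α n) * θ * lyapunov (y n) (x n) / α n :=
      div_nonneg (mul_nonneg (mul_nonneg (sub_nonneg.mpr h5.le) hθ.le) (lyapunov_nonneg _ _)) h4.le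
    simp only [hβ, map_sub] at hβn ⊢
    linarith
  rw [map_sub] at hpS
  linarith

end Iteration

end BanachTseng

/-! ### Assembly of the main theorem. -/

theorem mainTheorem4 {E : Type*} [NormedAddCommGroup E] [NormedSpace ℝ E] [CompleteSpace E]
    (hconv : BanachTseng.TwoUniformlyConvex E) (hsmooth : BanachTseng.UniformlySmooth E)
    (A : E → StrongDual ℝ E) (B : E → Set (StrongDual ℝ E)) (L : ℝ) (hL : 0 < L)
    (hA_mono : ∀ x y : E, 0 ≤ (A x - A y) (x - y))
    (hA_lip : ∀ x y : E, ‖A x - A y‖ ≤ L * ‖x - y‖)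
    (hB : BanachTseng.IsMaximalMonotone B)
    (hsol : (BanachTseng.solutionSet A B).Nonempty)
    (lam : ℕ → ℝ) (a b : ℝ) (ha : 0 < a)
    (hlam : ∀ n : ℕ, 1 ≤ n → a ≤ lam n ∧ lam n ≤ b)
    -- `b < 1 / (√2 μ κ L)`, cleared of the denominator
    (hb : b * (Real.sqrt 2 * BanachTseng.uniformConvexityConst E *
      BanachTseng.uniformSmoothnessConst (StrongDual ℝ E) * L) < 1)
    (α : ℕ → ℝ) (hα : ∀ n : ℕ, 1 ≤ n → 0 < α n ∧ α n < 1)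
    (hα_lim : Tendsto α atTop (𝓝 0))
    (hα_sum : Tendsto (fun N : ℕ => ∑ n ∈ Finset.Icc 1 N, α n) atTop atTop)
    (x y w : ℕ → E)
    (hy : ∀ n : ℕ, 1 ≤ n → y n = BanachTseng.resolvent B (lam n)
      (BanachTseng.dualityInv (BanachTseng.dualityMap (x n) - lam n • A (x n))))
    (hw : ∀ n : ℕ, 1 ≤ n → w n = BanachTseng.dualityInv
      (BanachTseng.dualityMap (y n) - lam n • (A (y n) - A (x n))))
    (hx : ∀ n : ℕ, 1 ≤ n → x (n + 1) = BanachTseng.dualityInv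
      (α n • BanachTseng.dualityMap (x 1) + (1 - α n) • BanachTseng.dualityMap (w n))) :
    ∃ z : E,
      (∀ z' : E, BanachTseng.IsGeneralizedProjection (BanachTseng.solutionSet A B) (x 1) z' ↔
        z' = z) ∧
      Tendsto x atTop (𝓝 z) := by
  set μ := BanachTseng.uniformConvexityConst E with hμ
  set κ := BanachTseng.uniformSmoothnessConst (StrongDual ℝ E) with hκ
  have hμ1 : 1 ≤ μ := hconv.uniformConvexityConst_mem.1
  have hμ0 : 0 < μ := by linarith
  have hκ0 : 0 ≤ κ := BanachTseng.uniformSmoothnessConst_nonneg _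
  have hc : BanachTseng.StronglyConvexSq E (μ⁻¹ ^ 2) := hconv.stronglyConvexSq
  have hc0 : 0 < μ⁻¹ ^ 2 := by positivity
  have hrefl := hc.reflexive hc0
  have hsurj := BanachTseng.exists_mem_dualitySet hc0 hc
  have hinv := BanachTseng.dualityMap_dualityInv hc0 hc hsmooth
  have hne : ∃ x, (B x).Nonempty := by
    obtain ⟨x, v, hv, -⟩ := hsol
    exact ⟨x, v, hv⟩
  have hS : ∀ z, z ∈ BanachTseng.solutionSet A B ↔ ∀ y, ∀ v ∈ B y, 0 ≤ (A y + v) (y - z) := fun z =>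
    BanachTseng.mem_solutionSet_iff hrefl hsurj hL hA_mono hA_lip hB hne
  obtain ⟨hcl, hcv⟩ := BanachTseng.isClosed_solutionSet_and_convex hS
  obtain ⟨z, hzS, hproj, hvar⟩ := BanachTseng.exists_generalizedProjection hc0 hc hsmooth hsol hcl hcv (x 1)
  have hlam0 : ∀ n, 1 ≤ n → 0 < lam n := fun n hn => ha.trans_le (hlam n hn).1
  have hb0 : 0 < b := (hlam0 1 le_rfl).trans_le (hlam 1 le_rfl).2
  have hres : ∀ n, 1 ≤ n → ∃ v ∈ B (y n),
      BanachTseng.dualityMap (x n) - lam n • A (x n) = BanachTseng.dualityMap (y n) + lam n • v := by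
    intro n hn
    have := BanachTseng.resolvent_spec hrefl hsurj hsmooth hB hne (hlam0 n hn)
      (BanachTseng.dualityInv (BanachTseng.dualityMap (x n) - lam n • A (x n)))
    rwa [← hy n hn, hinv] at this
  choose! v hvB hv using hres
  have hJw : ∀ n, 1 ≤ n →
      BanachTseng.dualityMap (w n) = BanachTseng.dualityMap (y n) - lam n • (A (y n) - A (x n)) := by
    intro n hn
    rw [hw n hn, hinv]
  have hJx : ∀ n, 1 ≤ n →
      BanachTseng.dualityMap (x (n + 1)) = α n • BanachTseng.dualityMap (x 1) + (1 - α n) • BanachTseng.dualityMap (w n) := by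
    intro n hn
    rw [hx n hn, hinv]
  -- `q²` is the fraction of `φ(y n, x n)` lost to the forward correction, so `θ = 1 - q²` remains.
  set q := b * (Real.sqrt 2 * μ * κ * L) with hq
  have hq0 : 0 ≤ q := by positivity
  have hq2 : q ^ 2 = 2 * κ ^ 2 * (b * L) ^ 2 * μ ^ 2 := by
    rw [hq, mul_pow, mul_pow, mul_pow, mul_pow, Real.sq_sqrt zero_le_two]
    ring
  refine ⟨z, hproj, BanachTseng.tendsto_halpern_forwardBackwardForward hc0 hc hsmooth hA_mono hA_lip hB.1 ha
    (θ := 1 - q ^ 2) (by nlinarith) hlam hα hα_lim hα_sum hvB hv hJw hJx (fun n hn => ?_)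
    fun p hp => hvar p ((hS p).mpr hp)⟩
  have h1 := BanachTseng.lyapunov_le_forwardBackwardForward hc0 hc (hlam0 n hn).le (hv n hn) (hJw n hn)
    ((hS z).mp hzS (y n) (v n) (hvB n hn))
  have h2 : lam n * ‖A (y n) - A (x n)‖ ≤ b * L * ‖y n - x n‖ := by
    rw [mul_assoc]
    exact mul_le_mul (hlam n hn).2 (hA_lip _ _) (norm_nonneg _) hb0.le
  have h3 : (lam n * ‖A (y n) - A (x n)‖) ^ 2 ≤ (b * L * ‖y n - x n‖) ^ 2 :=
    pow_le_pow_left₀ (mul_nonneg (hlam0 n hn).le (norm_nonneg _)) h2 2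
  have h4 : ‖y n - x n‖ ^ 2 ≤ μ ^ 2 * BanachTseng.lyapunov (y n) (x n) := by
    have := hc.le_lyapunov (y n) (x n)
    rwa [inv_pow, inv_mul_le_iff₀ (by positivity)] at this
  have h5 : 2 * κ ^ 2 * (lam n * ‖A (y n) - A (x n)‖) ^ 2 ≤ q ^ 2 * BanachTseng.lyapunov (y n) (x n) :=
    calc 2 * κ ^ 2 * (lam n * ‖A (y n) - A (x n)‖) ^ 2
        ≤ 2 * κ ^ 2 * (b * L * ‖y n - x n‖) ^ 2 := by gcongr
      _ = 2 * κ ^ 2 * (b * L) ^ 2 * ‖y n - x n‖ ^ 2 := by ring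
      _ ≤ 2 * κ ^ 2 * (b * L) ^ 2 * (μ ^ 2 * BanachTseng.lyapunov (y n) (x n)) := by gcongr
      _ = q ^ 2 * BanachTseng.lyapunov (y n) (x n) := by rw [hq2]; ring
  linarith
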